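/- Write $\mathbb N_0=\{0,1,2,\dots\}$, $T_yf=f(\cdot-y)$ and $D_Mf=|\det M|^{1/2}f(M\,\cdot)$ on $L^2(\mathbb R^2)$, $M^\sharp=(M^T)^{-1}$, let $\hat f$ be the Fourier transform with kernel $e^{-2\pi i\langle x,\omega\rangle}$, and put $$A_1=\begin{pmatrix}4&0\\0&2\end{pmatrix},\quad S_1=\begin{pmatrix}1&1\\0&1\end{pmatrix},\quad A_2=\begin{pmatrix}2&0\\0&4\end{pmatrix},\quad S_2=\begin{pmatrix}1&0\\1&1\end{pmatrix}.$$ Let $\phi,\psi_1,\psi_2\in L^2(\mathbb R^2)$, let $\Gamma=C\mathbb Z^2$, $C\in GL_2(\mathbb R)$, be a full-rank lattice in $\mathbb R^2$, and let $\Gamma^*=C^\sharp\mathbb Z^2$ be its dual lattice. The cone-adapted shearlet system is the family $$\{T_\gamma\phi\}_{\gamma\in\Gamma}\ \cup\ \{D_{S_i^kA_i^j}T_\gamma\psi_i\}_{\,i\in\{1,2\},\ j\in\mathbb N_0,\ k\in\{-2^j,\dots,2^j\},\ \gamma\in\Gamma}.$$ For $\alpha\in\mathbb R^2$ let $\kappa_i(\alpha)$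 be the set of all $(j,k)$ with $j\in\mathbb N_0$, $|k|\le 2^j$ and $\alpha\in(S_i^kA_i^j)^T\Gamma^*$, and let $\Lambda=\Gamma^*\cup\bigcup_{i,j,k}(S_i^kA_i^j)^T\Gamma^*$. Define the auto-correlation functions $$t_0(\omega)=\frac1{|\det C|}\Big(|\hat\phi(\omega)|^2+\sum_{i=1}^2\sum_{j=0}^\infty\sum_{k=-2^j}^{2^j}\big|\hat\psi_i\big((S_i^\sharp)^kA_i^{-j}\omega\big)\big|^2\Big)\in[0,\infty]$$ and, for $\alpha\in\Lambda\setminus\{0\}$ (the sums being finite), $$t_\alpha(\omega)=\frac1{|\det C|}\Big(\mathbf 1_{\Gamma^*}(\alpha)\,\hat\phi(\omega)\overline{\hat\phi(\omega+\alpha)}+\sum_{i=1}^2\sum_{(j,k)\in\kappa_i(\alpha)}\hat\psi_i\big((S_i^\sharp)^kA_i^{-j}\omega\big)\overline{\hat\psi_i\big((S_i^\sharp)^kA_i^{-j}(\omega+\alpha)\big)}\Big).$$ (a) If $$b_1:=\operatorname*{ess\,sup}_{\omega\in\mathbb R^2}\sum_{\alpha\in\Lambda}|t_\alpha(\omega)|<\infty\quad\text{and}\quad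 a_1:=\operatorname*{ess\,inf}_{\omega\in\mathbb R^2}\Big(t_0(\omega)-\sum_{\alpha\in\Lambda\setminus\{0\}}|t_\alpha(\omega)|\Big)>0,$$ then the cone-adapted shearlet system is a frame for $L^2(\mathbb R^2)$ with frame bounds $a_1$ and $b_1$. (b) Suppose that $A_i\Gamma^*\subseteq\Gamma^*$ and $S_i^T\Gamma^*=\Gamma^*$ for $i=1,2$ (for instance $\Gamma=c\mathbb Z^2$, $c>0$). Then $\Lambda=\Gamma^*$; each $\alpha\in\Gamma^*\setminus\{0\}$ can, for each $i\in\{1,2\}$, be written as $\alpha=A_i^{m_i}q_i$ with unique $m_i\in\mathbb N_0$ and $q_i\in\Gamma^*\setminus A_i\Gamma^*$; and for all $\omega\in\mathbb R^2$ $$t_\alpha(\omega)=\frac1{|\det C|}\Big(\hat\phi(\omega)\overline{\hat\phi(\omega+\alpha)}+\sum_{i=1}^2\sum_{j=0}^{m_i}\sum_{k=-2^j}^{2^j}\hat\psi_i\big((S_i^\sharp)^kA_i^{-j}\omega\big)\overline{\hat\psi_i\big((S_i^\sharp)^kA_i^{-j}(\omega+\alpha)\big)}\Big).$$ Hence the estimate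 in (a) holds for such $\Gamma$ with these explicit functions and with sums over $\Gamma^*$. -/

import Mathlib

open MeasureTheory Matrix FourierTransform
open scoped ENNReal ComplexConjugate InnerProductSpace

namespace ConeShearlet

noncomputable section

/-- The plane `ℝ²` with its Euclidean structure. -/
abbrev Plane : Type := EuclideanSpace ℝ (Fin 2)

/-- The complex Hilbert space `L²(ℝ²)`. -/
abbrev L2 : Type := Lp ℂ 2 (volume : Measure Plane)

/-- The group `GL₂(ℝ)`. -/
abbrev GL2 : Type := GL (Fin 2) ℝ

/-- The action `x ↦ M x` of an invertible matrix on the plane. -/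
def act (M : GL2) : Plane →ₗ[ℝ] Plane := Matrix.toEuclideanLin (M : Matrix (Fin 2) (Fin 2) ℝ)

/-- `M♯ = (Mᵀ)⁻¹`. -/
def sharp (M : GL2) : GL2 where
  val := ((M⁻¹ : GL2) : Matrix (Fin 2) (Fin 2) ℝ)ᵀ
  inv := (M : Matrix (Fin 2) (Fin 2) ℝ)ᵀ
  val_inv := by rw [← Matrix.transpose_mul, Units.mul_inv, Matrix.transpose_one]
  inv_val := by rw [← Matrix.transpose_mul, Units.inv_mul, Matrix.transpose_one]

/-- `|det M|`, the modulus of the automorphism `x ↦ M x`. -/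
def absDet (M : GL2) : ℝ := |(M : Matrix (Fin 2) (Fin 2) ℝ).det|

/-- The full-rank lattice `C ℤ²`. -/
def lattice (C : GL2) : Set Plane :=
  Set.range fun n : Fin 2 → ℤ => act C (WithLp.toLp 2 fun i => (n i : ℝ))

/-- The dual lattice `Γ* = C♯ ℤ²` of `Γ = C ℤ²`. -/
def dualLattice (C : GL2) : Set Plane := lattice (sharp C)

/-! ### Translations and dilations on `L²(ℝ²)` -/

/-- `T_y f = f(· - y)`. -/
def translate (y : Plane) (f : L2) : L2 :=
  Lp.compMeasurePreserving (fun x => x - y) (measurePreserving_sub_right volume y) f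

theorem act_mul_apply (M N : GL2) (x : Plane) : act (M * N) x = act M (act N x) := by
  simp [act, Matrix.toLpLin_apply]

theorem act_one_apply (x : Plane) : act 1 x = x := by
  simp [act]

theorem det_act_ne_zero (M : GL2) : LinearMap.det (act M) ≠ 0 := by
  have h : act M ∘ₗ act M⁻¹ = LinearMap.id := by
    ext1 x
    rw [LinearMap.comp_apply, ← act_mul_apply, mul_inv_cancel, act_one_apply, LinearMap.id_apply]
  have h2 := congrArg LinearMap.det h
  rw [LinearMap.det_comp, LinearMap.det_id] at h2
  exact left_ne_zero_of_mul_eq_one h2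

theorem memLp_dilate (M : GL2) (f : L2) :
    MemLp (fun x : Plane => ((Real.sqrt (absDet M) : ℝ) : ℂ) * f (act M x)) 2 volume := by
  have hmap := Measure.map_linearMap_addHaar_eq_smul_addHaar (volume : Measure Plane)
    (det_act_ne_zero M)
  have hf : MemLp (f : Plane → ℂ) 2 (Measure.map (act M) volume) := by
    rw [hmap]
    exact (Lp.memLp f).smul_measure ENNReal.ofReal_ne_top
  have hc : Continuous (act M) := LinearMap.continuous_of_finiteDimensional _
  exact (hf.comp_of_map hc.measurable.aemeasurable).const_mul _

/-- The unitary dilation `D_M f = |det M|^{1/2} f(M ·)`. -/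
def dilate (M : GL2) (f : L2) : L2 := (memLp_dilate M f).toLp _

/-! ### The cone-adapted shearlet system -/

/-- The scaling matrices `A₁ = diag(4,2)` and `A₂ = diag(2,4)`. The index `i ∈ {1,2}` is
`0, 1 : Fin 2`. -/
def scalingMatrix (i : Fin 2) : GL2 :=
  ![Matrix.GeneralLinearGroup.mkOfDetNeZero !![4, 0; 0, 2] (by norm_num [Matrix.det_fin_two]),
    Matrix.GeneralLinearGroup.mkOfDetNeZero !![2, 0; 0, 4] (by norm_num [Matrix.det_fin_two])] i

/-- The shear matrices `S₁` (upper triangular) and `S₂` (lower triangular). -/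
def shearMatrix (i : Fin 2) : GL2 :=
  ![Matrix.GeneralLinearGroup.mkOfDetNeZero !![1, 1; 0, 1] (by norm_num [Matrix.det_fin_two]),
    Matrix.GeneralLinearGroup.mkOfDetNeZero !![1, 0; 1, 1] (by norm_num [Matrix.det_fin_two])] i

/-- Pairs `(j, k)` with `j ∈ ℕ₀` and `k ∈ {-2^j, …, 2^j}`. -/
abbrev ScaleShear : Type := Σ j : ℕ, ↥(Finset.Icc (-(2 : ℤ) ^ j) ((2 : ℤ) ^ j))

/-- The index set of the system: translations of `φ`, and triples `i`, `(j, k)`, `γ`. -/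
abbrev SystemIndex (C : GL2) : Type := ↥(lattice C) ⊕ (Fin 2 × ScaleShear × ↥(lattice C))

/-- The cone-adapted shearlet system
`{T_γ φ} ∪ {D_{S_i^k A_i^j} T_γ ψ_i}` over the lattice `C ℤ²`. -/
def shearletSystem (C : GL2) (φ : L2) (ψ : Fin 2 → L2) : SystemIndex C → L2
  | .inl γ => translate γ φ
  | .inr (i, s, γ) =>
      dilate (shearMatrix i ^ (s.2 : ℤ) * scalingMatrix i ^ s.1) (translate γ (ψ i))

/-- `g` is a frame with frame bounds `A` and `B`. -/
def IsFrameWithBounds {ι : Type*} (g : ι → L2) (A B : ℝ) : Prop :=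
  0 < A ∧ 0 < B ∧ ∀ f : L2,
    Summable (fun n => ‖⟪g n, f⟫_ℂ‖ ^ 2) ∧
    A * ‖f‖ ^ 2 ≤ ∑' n, ‖⟪g n, f⟫_ℂ‖ ^ 2 ∧
    ∑' n, ‖⟪g n, f⟫_ℂ‖ ^ 2 ≤ B * ‖f‖ ^ 2

/-! ### Auto-correlation functions -/

/-- The frequency map `ω ↦ (S_i♯)^k A_i^{-j} ω`. -/
def freq (i : Fin 2) (j : ℕ) (k : ℤ) (ω : Plane) : Plane :=
  act (sharp (shearMatrix i) ^ k * scalingMatrix i ^ (-(j : ℤ))) ω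

/-- The set `κ_i(α)` of the `(j, k)` for which `α` lies in the annihilator
`(S_i^k A_i^j)ᵀ Γ*` of the translation lattice of the `(i, j, k)` layer. -/
def kappa (C : GL2) (i : Fin 2) (α : Plane) : Set ScaleShear :=
  {s | freq i s.1 s.2 α ∈ dualLattice C}

/-- The union `Λ` of the annihilators of all translation lattices of the system. -/
def annihilatorUnion (C : GL2) : Set Plane :=
  {α | α ∈ dualLattice C ∨ ∃ i, (kappa C i α).Nonempty}

/-- The Calderón sum `t_0`, a series of non-negative terms with values in `[0, ∞]`. -/
def t0 (C : GL2) (φ : L2) (ψ : Fin 2 → L2) (ω : Plane) : ℝ≥0∞ :=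
  ENNReal.ofReal (absDet C)⁻¹ *
    (‖(𝓕 φ : L2) ω‖ₑ ^ 2 +
      ∑ i : Fin 2, ∑' s : ScaleShear, ‖(𝓕 (ψ i) : L2) (freq i s.1 s.2 ω)‖ₑ ^ 2)

open Classical in
/-- The auto-correlation function `t_α` for `α ≠ 0`. The sets `κ_i(α)` are then finite (every
bounded set meets all but finitely many of the annihilators at most in `0`), so that the sums
have finitely many terms. -/
def t (C : GL2) (φ : L2) (ψ : Fin 2 → L2) (α ω : Plane) : ℂ :=
  ((absDet C)⁻¹ : ℝ) *
    ((if α ∈ dualLattice C then (𝓕 φ : L2) ω * conj ((𝓕 φ : L2) (ω + α)) else 0) +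
      ∑ i : Fin 2, ∑' s : ↥(kappa C i α),
        (𝓕 (ψ i) : L2) (freq i s.1.1 s.1.2 ω) *
          conj ((𝓕 (ψ i) : L2) (freq i s.1.1 s.1.2 (ω + α))))

/-- The remainder `∑_{α ∈ Λ \ {0}} |t_α(ω)|`, with values in `[0, ∞]`. -/
def remainder (C : GL2) (φ : L2) (ψ : Fin 2 → L2) (ω : Plane) : ℝ≥0∞ :=
  ∑' α : ↥(annihilatorUnion C \ {0}), ‖t C φ ψ α ω‖ₑ

/-- `b₁ = esssup_ω ∑_{α ∈ Λ} |t_α(ω)|`. -/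
def b₁ (C : GL2) (φ : L2) (ψ : Fin 2 → L2) : ℝ≥0∞ :=
  essSup (fun ω => t0 C φ ψ ω + remainder C φ ψ ω) volume

/-- `a₁ = essinf_ω (t_0(ω) - ∑_{α ∈ Λ \ {0}} |t_α(ω)|)`. -/
def a₁ (C : GL2) (φ : L2) (ψ : Fin 2 → L2) : EReal :=
  essInf (fun ω => (t0 C φ ψ ω : EReal) - (remainder C φ ψ ω : EReal)) volume

/-- The lattice is adapted to the matrices: `A_i Γ* ⊆ Γ*` and `S_iᵀ Γ* = Γ*`, `i = 1, 2`. The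
second condition is written as `S_i♯ Γ* = Γ*`. -/
def IsAdapted (C : GL2) : Prop :=
  ∀ i : Fin 2, act (scalingMatrix i) '' dualLattice C ⊆ dualLattice C ∧
    act (sharp (shearMatrix i)) '' dualLattice C = dualLattice C

/-- The pair `(m, q)` is a decomposition `α = A_i^m q` with `q ∈ Γ* \ A_i Γ*`. -/
def IsDecomposition (C : GL2) (i : Fin 2) (α : Plane) (m : ℕ) (q : Plane) : Prop :=
  q ∈ dualLattice C \ act (scalingMatrix i) '' dualLattice C ∧ α = act (scalingMatrix i ^ m) q

end

end ConeShearlet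

namespace ConeShearlet

noncomputable section

/-! ### Linear algebra of the plane -/

/-! On the Fourier side `D_M T_γ ψ` becomes a character times `ψ̂(M♯ω)`, up to the factor `|det
M|^{-1/2}` (`fourier_dilate_translate`). For fixed `M`, the coefficients `⟪D_M T_γ ψ, f⟫` are
therefore Fourier coefficients of the periodization of `conj ψ̂(M♯ω) f̂(ω)` over the annihilator
`MᵀΓ*`. Parseval on the torus and unfolding turn their square sum into `|det C|⁻¹ ∑_{α ∈ MᵀΓ*} ∫
f̂(ω) conj f̂(ω+α) conj(ψ̂(M♯ω) conj ψ̂(M♯(ω+α)))` (`hasSum_sq_inner_layer`).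

Summing over the layers and collecting equal `α` gives `∫ |f̂|² t_0 + ∑_{α ≠ 0} ∫ f̂ conj f̂(·+α)
conj t_α` (`exists_hasSum_sq_inner_layerSystem`). Since `2|xy| ≤ |x|² + |y|²` and `|t_α(ω-α)| =
|t_{-α}(ω)|`, the second part is at most `∫ |f̂|² ∑_{α ≠ 0} |t_α|` in modulus, and both frame bounds
follow.

The rearrangements are legitimate when `f̂` is continuous with compact support: then only bounded
`α` matter, and the annihilators are locally finite (`locallyFinite_shearletMatrix`). This holds
because `(S_i♯)^k A_i^{-j}` with `|k| ≤ 2^j` contracts by `3/2^j`, while the non-zero vectors of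
`Γ*` stay away from `0`. Such `f` are dense, and `isFrameWithBounds_of_dense` extends the
inequalities.

For adapted lattices the shears preserve `Γ*`, so `(j,k) ∈ κ_i(α)` only depends on whether
`A_i^{-j}α ∈ Γ*`, which means `j ≤ m_i`. The exponent `m_i` exists because `κ_i(α)` is finite. -/

theorem sharp_mul (M N : GL2) : sharp (M * N) = sharp M * sharp N := by
  ext1
  simp [sharp, Matrix.transpose_mul]

theorem sharp_one : sharp 1 = 1 := by
  ext1
  simp [sharp]

/-- `M ↦ M♯` as a group homomorphism. -/
def sharpHom : GL2 →* GL2 where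
  toFun := sharp
  map_one' := sharp_one
  map_mul' := sharp_mul

theorem sharp_zpow (M : GL2) (k : ℤ) : sharp (M ^ k) = sharp M ^ k := map_zpow sharpHom M k

theorem sharp_inv (M : GL2) : sharp M⁻¹ = (sharp M)⁻¹ := map_inv sharpHom M

theorem act_inv_act (M : GL2) (x : Plane) : act M⁻¹ (act M x) = x := by
  rw [← act_mul_apply, inv_mul_cancel, act_one_apply]

theorem act_act_inv (M : GL2) (x : Plane) : act M (act M⁻¹ x) = x := by
  rw [← act_mul_apply, mul_inv_cancel, act_one_apply]

theorem act_injective (M : GL2) : Function.Injective (act M) :=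
  Function.LeftInverse.injective (act_inv_act M)

/-- The action of an invertible matrix as a continuous linear equivalence. -/
def actEquiv (M : GL2) : Plane ≃L[ℝ] Plane :=
  ({ act M with
      invFun := act M⁻¹
      left_inv := act_inv_act M
      right_inv := act_act_inv M } : Plane ≃ₗ[ℝ] Plane).toContinuousLinearEquiv

@[simp] theorem actEquiv_apply (M : GL2) (x : Plane) : actEquiv M x = act M x := rfl

theorem continuous_act (M : GL2) : Continuous (act M) := (actEquiv M).continuous

theorem absDet_pos (M : GL2) : 0 < absDet M :=
  abs_pos.2 ((Matrix.isUnit_iff_isUnit_det _).1 M.isUnit).ne_zero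

theorem absDet_mul (M N : GL2) : absDet (M * N) = absDet M * absDet N := by
  simp [absDet, abs_mul]

theorem absDet_one : absDet 1 = 1 := by
  simp [absDet]

theorem absDet_inv (M : GL2) : absDet M⁻¹ = (absDet M)⁻¹ := by
  refine eq_inv_of_mul_eq_one_left ?_
  rw [← absDet_mul, inv_mul_cancel, absDet_one]

theorem absDet_sharp (M : GL2) : absDet (sharp M) = (absDet M)⁻¹ := by
  rw [← absDet_inv]
  simp only [absDet, sharp, Matrix.det_transpose]

theorem abs_det_act (M : GL2) : |LinearMap.det (act M)| = absDet M := by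
  rw [act, Matrix.toEuclideanLin, LinearMap.det_toLpLin, absDet]

theorem inner_act_sharp (M : GL2) (x y : Plane) : ⟪act M x, act (sharp M) y⟫_ℝ = ⟪x, y⟫_ℝ := by
  have h : ∀ (N : Matrix (Fin 2) (Fin 2) ℝ) (x y : Plane),
      ⟪Matrix.toEuclideanLin N x, y⟫_ℝ = ⟪x, Matrix.toEuclideanLin Nᵀ y⟫_ℝ := by
    intro N x y
    simp [Matrix.toLpLin_apply, PiLp.inner_apply, Fin.sum_univ_two]
    ring
  rw [act, h]
  have : Matrix.toEuclideanLin (M : Matrix (Fin 2) (Fin 2) ℝ)ᵀ (act (sharp M) y) = y := by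
    simp only [act, sharp, Matrix.toLpLin_apply, Matrix.mulVec_mulVec]
    rw [← Matrix.transpose_mul, Units.inv_mul]
    simp
  rw [this]

/-! ### Change of variables -/

theorem map_act_volume (M : GL2) :
    Measure.map (act M) (volume : Measure Plane) = ENNReal.ofReal (absDet M)⁻¹ • volume := by
  rw [Measure.map_linearMap_addHaar_eq_smul_addHaar (volume : Measure Plane) (det_act_ne_zero M),
    abs_inv, abs_det_act]

theorem measurableEmbedding_act (M : GL2) : MeasurableEmbedding (act M) :=
  (actEquiv M).toHomeomorph.measurableEmbedding

theorem integral_comp_act (M : GL2) {E : Type*} [NormedAddCommGroup E] [NormedSpace ℝ E]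
    (f : Plane → E) : ∫ x, f (act M x) = (absDet M)⁻¹ • ∫ x, f x := by
  rw [← (measurableEmbedding_act M).integral_map, map_act_volume, integral_smul_measure,
    ENNReal.toReal_ofReal (inv_nonneg.2 (absDet_pos M).le)]

theorem quasiMeasurePreserving_act (M : GL2) :
    Measure.QuasiMeasurePreserving (act M) (volume : Measure Plane) volume := by
  refine ⟨(continuous_act M).measurable, ?_⟩
  rw [map_act_volume]
  exact Measure.smul_absolutelyContinuous

theorem memLp_comp_act {E : Type*} [NormedAddCommGroup E] {f : Plane → E} {p : ℝ≥0∞}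
    (hf : MemLp f p volume) (M : GL2) : MemLp (fun x => f (act M x)) p volume := by
  have h : MemLp f p (Measure.map (act M) volume) := by
    rw [map_act_volume]
    exact hf.smul_measure ENNReal.ofReal_ne_top
  exact h.comp_of_map (continuous_act M).measurable.aemeasurable

theorem memLp_comp_add_right {E : Type*} [NormedAddCommGroup E] {f : Plane → E} {p : ℝ≥0∞}
    (hf : MemLp f p volume) (y : Plane) : MemLp (fun x => f (x + y)) p volume :=
  hf.comp_measurePreserving (measurePreserving_add_right volume y)

/-! ### Parseval's identity for periodizations -/

/-- The half-open unit cube. -/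
def unitCube (d : Type*) : Set (d → ℝ) := {x | ∀ i, x i ∈ Set.Ioc (0 : ℝ) (0 + 1)}

/-- An integer vector as a real vector. -/
def intVec {d : Type*} (n : d → ℤ) : d → ℝ := fun i => (n i : ℝ)

section

attribute [local instance] instMeasureSpaceUnitAddCircle

variable {d : Type*}

theorem measurableSet_unitCube [Fintype d] : MeasurableSet (unitCube d) :=
  MeasurableSet.univ_pi' fun _ => measurableSet_Ioc

theorem exists_sub_intVec_mem_unitCube (x : d → ℝ) :
    ∃ n : d → ℤ, x - intVec n ∈ unitCube d := by
  -- The cube is open on the left and closed on the right, hence the ceiling minus one instead of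
  -- the floor.
  refine ⟨fun i => ⌈x i⌉ - 1, fun i => ?_⟩
  have h1 := Int.ceil_lt_add_one (x i)
  have h2 := Int.le_ceil (x i)
  simp only [intVec, Pi.sub_apply, Set.mem_Ioc]
  push_cast
  constructor <;> linarith

theorem eq_of_sub_intVec_mem_unitCube {x : d → ℝ} {m n : d → ℤ}
    (hm : x - intVec m ∈ unitCube d) (hn : x - intVec n ∈ unitCube d) : m = n := by
  ext i
  have h1 := hm i
  have h2 := hn i
  simp only [intVec, Pi.sub_apply, Set.mem_Ioc] at h1 h2
  have h3 : (m i : ℝ) < n i + 1 := by linarith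
  have h4 : (n i : ℝ) < m i + 1 := by linarith
  norm_cast at h3 h4
  lia

variable [Fintype d]

/-- The integral of a function supported in finitely many integer translates of the unit cube is
the integral over the unit cube of its periodization. -/
theorem sum_setIntegral_unitCube {F : (d → ℝ) → ℂ} (hF : Integrable F)
    (T : Finset (d → ℤ)) (hT : ∀ x ∈ unitCube d, ∀ m ∉ T, F (x + intVec m) = 0) :
    ∑ m ∈ T, ∫ x in unitCube d, F (x + intVec m) = ∫ x, F x := by
  have h1 : ∀ m : d → ℤ, ∫ x in unitCube d, F (x + intVec m) =
      ∫ x, (unitCube d).indicator (fun _ => F x) (x - intVec m) := by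
    intro m
    rw [← integral_indicator measurableSet_unitCube,
      ← integral_sub_right_eq_self _ (intVec m)]
    refine integral_congr_ae (Filter.Eventually.of_forall fun x => ?_)
    simp [Set.indicator]
  have h2 : ∀ m : d → ℤ, Integrable
      (fun x => (unitCube d).indicator (fun _ => F x) (x - intVec m)) := by
    intro m
    have hm : MeasurableSet ((fun x : d → ℝ => x - intVec m) ⁻¹' unitCube d) :=
      (measurable_id.sub_const _) measurableSet_unitCube
    exact (hF.indicator hm).congr (Filter.Eventually.of_forall fun x => rfl)
  simp_rw [h1]
  rw [← integral_finsetSum _ fun m _ => h2 m]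
  refine integral_congr_ae (Filter.Eventually.of_forall fun x => ?_)
  obtain ⟨n, hn⟩ := exists_sub_intVec_mem_unitCube x
  have h3 : ∀ m ≠ n, (unitCube d).indicator (fun _ => F x) (x - intVec m) = 0 := fun m hm =>
    Set.indicator_of_notMem (fun h => hm (eq_of_sub_intVec_mem_unitCube h hn)) _
  have h4 : n ∉ T → (unitCube d).indicator (fun _ => F x) (x - intVec n) = 0 := by
    intro h
    rw [Set.indicator_of_mem hn]
    simpa using hT _ hn n h
  change ∑ m ∈ T, (unitCube d).indicator (fun _ => F x) (x - intVec m) = F x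
  rw [Finset.sum_eq_single n (fun m _ hm => h3 m hm) h4, Set.indicator_of_mem hn]

theorem mFourier_add_intVec (n m : d → ℤ) (x : d → ℝ) :
    UnitAddTorus.mFourier n (fun i => ((x + intVec m) i : UnitAddCircle)) =
      UnitAddTorus.mFourier n (fun i => (x i : UnitAddCircle)) := by
  congr 1
  ext i
  simp [intVec]

theorem hasSum_sq_integral_mFourier {H : (d → ℝ) → ℂ} (hH : MemLp H 2 volume)
    (hsm : Measurable H) (hH1 : Integrable H)
    (T : Finset (d → ℤ)) (hT : ∀ x ∈ unitCube d, ∀ m ∉ T, H (x + intVec m) = 0)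
    (S : Finset (d → ℤ)) (hS : ∀ x, ∀ m ∉ S, H x * conj (H (x + intVec m)) = 0) :
    HasSum (fun n : d → ℤ =>
      ((‖∫ x, UnitAddTorus.mFourier (-n) (fun i => (x i : UnitAddCircle)) * H x‖ ^ 2 : ℝ) : ℂ))
      (∑ m ∈ S, ∫ x, H x * conj (H (x + intVec m))) := by
  classical
  -- This agrees with the full periodization only on the unit cube, which is a fundamental domain,
  -- so that nothing more is needed.
  set P : (d → ℝ) → ℂ := fun x => ∑ m ∈ T, H (x + intVec m) with hP
  have hPm : Measurable P :=
    Finset.measurable_sum _ fun m _ => hsm.comp (measurable_id.add_const _)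
  have hshift : ∀ m : d → ℤ, MemLp (fun x => H (x + intVec m)) 2 volume := fun m =>
    hH.comp_measurePreserving (measurePreserving_add_right volume (intVec m))
  have hP2 : MemLp P 2 volume := memLp_finsetSum _ fun m _ => hshift m
  set p : UnitAddTorus d → ℂ :=
    fun y => P (UnitAddTorus.measurableEquivPiIoc (fun _ => (0 : ℝ)) y).1 with hp
  have hpP : ∀ x ∈ unitCube d, p (fun i => (x i : UnitAddCircle)) = P x := by
    intro x hx
    have := (UnitAddTorus.measurableEquivPiIoc (fun _ : d => (0 : ℝ))).apply_symm_apply ⟨x, hx⟩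
    rw [UnitAddTorus.coe_symm_measurableEquivPiIoc_apply] at this
    simp only [hp]
    rw [this]
  have hpm : Measurable p := hPm.comp
    (measurable_subtype_coe.comp (UnitAddTorus.measurableEquivPiIoc (fun _ => (0 : ℝ))).measurable)
  have hp2 : MemLp p 2 volume := by
    rw [memLp_two_iff_integrable_sq_norm hpm.aestronglyMeasurable]
    have h2 := (memLp_two_iff_integrable_sq_norm hPm.aestronglyMeasurable).1 hP2
    refine ⟨(hpm.norm.pow_const 2).aestronglyMeasurable, ?_⟩
    rw [hasFiniteIntegral_iff_enorm, UnitAddTorus.lintegral_preimage _ (fun _ => (0 : ℝ))]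
    calc _ = ∫⁻ x in unitCube d, ‖‖P x‖ ^ 2‖ₑ := by
          refine setLIntegral_congr_fun measurableSet_unitCube fun x hx => ?_
          change ‖‖p _‖ ^ 2‖ₑ = _
          rw [hpP x hx]
      _ ≤ ∫⁻ x, ‖‖P x‖ ^ 2‖ₑ := setLIntegral_le_lintegral _ _
      _ < ⊤ := h2.2
  have hcoef : ∀ n : d → ℤ, UnitAddTorus.mFourierCoeff (hp2.toLp p) n =
      ∫ x, UnitAddTorus.mFourier (-n) (fun i => (x i : UnitAddCircle)) * H x := by
    intro n
    set e : (d → ℝ) → ℂ := fun x => UnitAddTorus.mFourier (-n) (fun i => (x i : UnitAddCircle))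
      with he
    have hec : Continuous e := by
      refine (UnitAddTorus.mFourier (-n)).continuous.comp (continuous_pi fun i => ?_)
      exact (AddCircle.continuous_mk' 1).comp (continuous_apply i)
    have hint : Integrable (fun x => e x * H x) := by
      refine hH1.bdd_mul (c := 1) hec.aestronglyMeasurable (Filter.Eventually.of_forall fun x => ?_)
      exact (ContinuousMap.norm_coe_le_norm _ _).trans UnitAddTorus.mFourier_norm.le
    have hshift2 : ∀ m : d → ℤ, Integrable (fun x => e (x + intVec m) * H (x + intVec m)) :=
      fun m => hint.comp_add_right (intVec m)
    calc UnitAddTorus.mFourierCoeff (hp2.toLp p) n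
        = UnitAddTorus.mFourierCoeff p n :=
          integral_congr_ae (by
            filter_upwards [hp2.coeFn_toLp] with x hx
            rw [hx])
      _ = ∫ x in unitCube d, ∑ m ∈ T, e (x + intVec m) * H (x + intVec m) := by
          rw [UnitAddTorus.mFourierCoeff_eq_integral _ _ (fun _ => (0 : ℝ))]
          refine setIntegral_congr_fun measurableSet_unitCube fun x hx => ?_
          change UnitAddTorus.mFourier (-n) _ • p _ = _
          rw [hpP x hx, hP]
          simp only [smul_eq_mul, Finset.mul_sum, he]
          refine Finset.sum_congr rfl fun m _ => ?_
          rw [mFourier_add_intVec]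
      _ = ∑ m ∈ T, ∫ x in unitCube d, e (x + intVec m) * H (x + intVec m) :=
          integral_finsetSum _ fun m _ => (hshift2 m).integrableOn
      _ = _ := sum_setIntegral_unitCube hint T fun x hx m hm => by
          rw [hT x hx m hm, mul_zero]
  have hG : ∀ k : d → ℤ, Integrable (fun x => H x * conj (H (x + intVec k))) := fun k =>
    hH.integrable_mul ((hshift k).star)
  have hmain := UnitAddTorus.hasSum_sq_mFourierCoeff (hp2.toLp p)
  simp_rw [hcoef] at hmain
  have hval : ((∫ t, ‖(hp2.toLp p) t‖ ^ 2 : ℝ) : ℂ) =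
      ∑ m ∈ S, ∫ x, H x * conj (H (x + intVec m)) := by
    calc ((∫ t, ‖(hp2.toLp p) t‖ ^ 2 : ℝ) : ℂ)
        = ((∫ t, ‖p t‖ ^ 2 : ℝ) : ℂ) := by
          congr 1
          refine integral_congr_ae ?_
          filter_upwards [hp2.coeFn_toLp] with x hx
          rw [hx]
      _ = ((∫ x in unitCube d, ‖P x‖ ^ 2 : ℝ) : ℂ) := by
          rw [UnitAddTorus.integral_preimage _ (fun _ => (0 : ℝ))]
          congr 1
          refine setIntegral_congr_fun measurableSet_unitCube fun x hx => ?_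
          rw [hpP x hx]
      _ = ∫ x in unitCube d, ∑ k ∈ S, ∑ m ∈ T,
            H (x + intVec m) * conj (H (x + intVec m + intVec k)) := by
          rw [← integral_complex_ofReal]
          refine setIntegral_congr_fun measurableSet_unitCube fun x hx => ?_
          rw [Complex.ofReal_pow, ← Complex.mul_conj', Finset.sum_comm]
          conv_lhs => rw [hP]
          simp only [Finset.sum_mul, map_sum]
          refine Finset.sum_congr rfl fun m _ => ?_
          rw [Finset.mul_sum]
          -- Translation by `m` does not match `S` with `T`; both sums are extended by zero to all
          -- integer vectors before substituting `m' = m + k`.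
          have e1 : ∑ m' ∈ T, H (x + intVec m) * conj (H (x + intVec m')) =
              ∑' m', H (x + intVec m) * conj (H (x + intVec m')) :=
            (tsum_eq_sum fun m' hm' => by rw [hT x hx m' hm', map_zero, mul_zero]).symm
          have e2 : ∑ k ∈ S, H (x + intVec m) * conj (H (x + intVec m + intVec k)) =
              ∑' k, H (x + intVec m) * conj (H (x + intVec m + intVec k)) :=
            (tsum_eq_sum fun k hk => hS _ k hk).symm
          rw [e1, e2, ← (Equiv.addLeft m).tsum_eq]
          refine tsum_congr fun k => ?_
          have : intVec ((Equiv.addLeft m) k) = intVec m + intVec k := by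
            ext i; simp [intVec]
          rw [this, add_assoc]
      _ = ∑ k ∈ S, ∑ m ∈ T, ∫ x in unitCube d,
            H (x + intVec m) * conj (H (x + intVec m + intVec k)) := by
          have hG' : ∀ k m : d → ℤ, Integrable
              (fun x => H (x + intVec m) * conj (H (x + intVec m + intVec k))) :=
            fun k m => (hG k).comp_add_right (intVec m)
          rw [integral_finsetSum _ fun k _ =>
            (integrable_finsetSum _ fun m _ => hG' k m).integrableOn]
          exact Finset.sum_congr rfl fun k _ =>
            integral_finsetSum _ fun m _ => (hG' k m).integrableOn
      _ = _ := Finset.sum_congr rfl fun k _ =>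
          sum_setIntegral_unitCube (hG k) T fun x hx m hm => by rw [hT x hx m hm, zero_mul]
  rw [← hval]
  exact_mod_cast hmain

end

/-! ### The Fourier transform of translates and dilates -/

/-- A weighted composition operator on `L²(ℝ²)` with an affine symbol and a bounded weight is
continuous. -/
theorem continuous_of_ae_eq_weight_mul_comp {T : L2 → L2} (N : GL2) (y : Plane) (c : Plane → ℂ)
    (K : ℝ) (hc : ∀ x, ‖c x‖ ≤ K) (hT : ∀ f : L2, T f =ᵐ[volume] fun x => c x * f (act N x + y)) :
    Continuous T := by
  have hqm : Measure.QuasiMeasurePreserving (fun x => act N x + y) (volume : Measure Plane)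
      volume :=
    (measurePreserving_add_right volume y).quasiMeasurePreserving.comp
      (quasiMeasurePreserving_act N)
  -- The Lipschitz constant is the bound of the weight times `|det N|^{-1/2}`, the norm of
  -- composition with `N` on `L²`.
  refine (LipschitzWith.of_dist_le_mul
    (K := Real.toNNReal K * ((ENNReal.ofReal (absDet N)⁻¹) ^ (2⁻¹ : ℝ)).toNNReal)
    fun f g => ?_).continuous
  rw [dist_eq_norm, dist_eq_norm, Lp.norm_def, Lp.norm_def]
  have h1 : (T f - T g : L2) =ᵐ[volume] fun x => c x * (f - g : L2) (act N x + y) := by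
    filter_upwards [Lp.coeFn_sub (T f) (T g), hT f, hT g, hqm.ae_eq_comp (Lp.coeFn_sub f g)]
      with x h1 h2 h3 h4
    simp only [Function.comp_apply, Pi.sub_apply] at h4
    rw [h1, Pi.sub_apply, h2, h3, h4]
    ring
  have h2 : eLpNorm (fun x => (f - g : L2) (act N x + y)) 2 volume =
      (ENNReal.ofReal (absDet N)⁻¹) ^ (2⁻¹ : ℝ) * eLpNorm (f - g : L2) 2 volume := by
    have e1 : eLpNorm (fun x => (f - g : L2) (act N x + y)) 2 volume =
        eLpNorm (fun x => (f - g : L2) (x + y)) 2 (Measure.map (act N) volume) := by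
      rw [eLpNorm_map_measure _ (continuous_act N).measurable.aemeasurable]
      · rfl
      · rw [map_act_volume]
        exact (memLp_comp_add_right (Lp.memLp (f - g)) y).1.smul_measure _
    rw [e1, map_act_volume, eLpNorm_smul_measure_of_ne_top (by norm_num)]
    rw [show (fun x => (f - g : L2) (x + y)) = (f - g : L2) ∘ (fun x => x + y) from rfl,
      eLpNorm_comp_measurePreserving (Lp.memLp (f - g)).1 (measurePreserving_add_right volume y)]
    simp [smul_eq_mul]
  have h3 : eLpNorm (T f - T g : L2) 2 volume ≤
      ENNReal.ofReal K * ((ENNReal.ofReal (absDet N)⁻¹) ^ (2⁻¹ : ℝ) *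
        eLpNorm (f - g : L2) 2 volume) := by
    rw [eLpNorm_congr_ae h1, ← h2]
    refine eLpNorm_le_mul_eLpNorm_of_ae_le_mul (Filter.Eventually.of_forall fun x => ?_) 2
    rw [norm_mul]
    exact mul_le_mul_of_nonneg_right (hc x) (norm_nonneg _)
  have htop : (ENNReal.ofReal (absDet N)⁻¹) ^ (2⁻¹ : ℝ) ≠ ⊤ :=
    ENNReal.rpow_ne_top_of_nonneg (by norm_num) ENNReal.ofReal_ne_top
  have h4 := ENNReal.toReal_mono
    (ENNReal.mul_ne_top ENNReal.ofReal_ne_top (ENNReal.mul_ne_top htop (Lp.memLp (f - g)).2.ne)) h3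
  rw [ENNReal.toReal_mul, ENNReal.toReal_mul] at h4
  refine h4.trans (le_of_eq ?_)
  push_cast
  rw [mul_assoc]
  rfl

theorem translate_ae_eq (y : Plane) (f : L2) : translate y f =ᵐ[volume] fun x => f (x - y) :=
  Lp.coeFn_compMeasurePreserving f (measurePreserving_sub_right volume y)

theorem dilate_ae_eq (M : GL2) (f : L2) :
    dilate M f =ᵐ[volume] fun x => ((Real.sqrt (absDet M) : ℝ) : ℂ) * f (act M x) :=
  (memLp_dilate M f).coeFn_toLp

theorem dilate_translate_ae_eq (M : GL2) (y : Plane) (f : L2) :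
    dilate M (translate y f) =ᵐ[volume]
      fun x => ((Real.sqrt (absDet M) : ℝ) : ℂ) * f (act M x - y) := by
  filter_upwards [dilate_ae_eq M (translate y f),
    (quasiMeasurePreserving_act M).ae_eq_comp (translate_ae_eq y f)] with x h1 h2
  simp only [Function.comp_apply] at h2
  rw [h1, h2]

theorem dilate_one (f : L2) : dilate 1 f = f := by
  refine Lp.ext ?_
  filter_upwards [dilate_ae_eq 1 f] with x h
  rw [h, absDet_one, act_one_apply]
  simp

theorem continuous_dilate_translate (M : GL2) (y : Plane) :
    Continuous fun f : L2 => dilate M (translate y f) :=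
  continuous_of_ae_eq_weight_mul_comp M (-y) (fun _ => ((Real.sqrt (absDet M) : ℝ) : ℂ)) _
    (fun _ => le_rfl) fun f => by
      simpa only [sub_eq_add_neg] using dilate_translate_ae_eq M y f

/-- The Fourier multiplier of `D_M T_y`. -/
def fourierWeight (M : GL2) (y : Plane) (ω : Plane) : ℂ :=
  (((Real.sqrt (absDet M))⁻¹ : ℝ) : ℂ) * (Real.fourierChar (-⟪y, act (sharp M) ω⟫_ℝ) : ℂ)

theorem continuous_fourierWeight (M : GL2) (y : Plane) : Continuous (fourierWeight M y) := by
  unfold fourierWeight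
  have := continuous_act (sharp M)
  fun_prop

theorem norm_fourierWeight (M : GL2) (y ω : Plane) :
    ‖fourierWeight M y ω‖ = (Real.sqrt (absDet M))⁻¹ := by
  rw [fourierWeight, norm_mul, Circle.norm_coe, mul_one, Complex.norm_real, Real.norm_eq_abs,
    abs_of_nonneg (by positivity)]

theorem memLp_fourierWeight_mul_comp (M : GL2) (y : Plane) (h : L2) :
    MemLp (fun ω => fourierWeight M y ω * h (act (sharp M) ω)) 2 volume :=
  (memLp_comp_act (Lp.memLp h) (sharp M)).of_le_mul (c := (Real.sqrt (absDet M))⁻¹)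
    ((continuous_fourierWeight M y).aestronglyMeasurable.mul
      (memLp_comp_act (Lp.memLp h) (sharp M)).1)
    (Filter.Eventually.of_forall fun ω => by rw [norm_mul, norm_fourierWeight])

/-- For Schwartz functions the transform is an honest integral, so one can substitute `z = Mx`,
using `⟨x,ω⟩ = ⟨Mx, M♯ω⟩`, and then shift by `y`. The general case follows from this one by density.
-/
theorem fourier_schwartz_comp (M : GL2) (y : Plane) (s : SchwartzMap Plane ℂ) (ω : Plane) :
    ∫ x, Real.fourierChar (-⟪x, ω⟫_ℝ) • (((Real.sqrt (absDet M) : ℝ) : ℂ) * s (act M x - y)) =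
      fourierWeight M y ω * 𝓕 (s : Plane → ℂ) (act (sharp M) ω) := by
  have e1 : ∀ x, Real.fourierChar (-⟪x, ω⟫_ℝ) •
      (((Real.sqrt (absDet M) : ℝ) : ℂ) * s (act M x - y)) =
      (fun z => Real.fourierChar (-⟪z, act (sharp M) ω⟫_ℝ) •
        (((Real.sqrt (absDet M) : ℝ) : ℂ) * s (z - y))) (act M x) := by
    intro x
    simp only [inner_act_sharp]
  refine ((integral_congr_ae (Filter.Eventually.of_forall e1)).trans (integral_comp_act M
    (fun z => Real.fourierChar (-⟪z, act (sharp M) ω⟫_ℝ) •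
      (((Real.sqrt (absDet M) : ℝ) : ℂ) * s (z - y))))).trans ?_
  rw [← integral_add_right_eq_self _ y, Real.fourier_eq, fourierWeight,
    ← integral_const_mul, ← integral_smul]
  refine integral_congr_ae (Filter.Eventually.of_forall fun z => ?_)
  simp only [add_sub_cancel_right, inner_add_left, neg_add, AddChar.map_add_eq_mul,
    Circle.smul_def, smul_eq_mul, Circle.coe_mul, Complex.real_smul]
  have h0 : Real.sqrt (absDet M) ≠ 0 := (Real.sqrt_pos.2 (absDet_pos M)).ne'
  have h2 : (absDet M)⁻¹ * Real.sqrt (absDet M) = (Real.sqrt (absDet M))⁻¹ := by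
    conv_lhs => rw [← Real.mul_self_sqrt (absDet_pos M).le]
    rw [Real.sqrt_mul_self (Real.sqrt_nonneg _)]
    field_simp
  rw [← h2]
  push_cast
  ring

/-- The Fourier transform of `D_M T_y f` is
`|det M|^{-1/2} e^{-2πi⟨y, M♯ω⟩} 𝓕 f (M♯ ω)`. -/
theorem fourier_dilate_translate (M : GL2) (y : Plane) (f : L2) :
    (𝓕 (dilate M (translate y f)) : L2) =ᵐ[volume]
      fun ω => fourierWeight M y ω * (𝓕 f : L2) (act (sharp M) ω) := by
  suffices h : (𝓕 (dilate M (translate y f)) : L2) =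
      (memLp_fourierWeight_mul_comp M y (𝓕 f : L2)).toLp _ by
    rw [h]
    exact MemLp.coeFn_toLp _
  have hcF : Continuous (fun f : L2 => (𝓕 f : L2)) := (Lp.fourierTransformₗᵢ Plane ℂ).continuous
  have hcW : Continuous fun h : L2 => (memLp_fourierWeight_mul_comp M y h).toLp _ :=
    continuous_of_ae_eq_weight_mul_comp (sharp M) 0 (fourierWeight M y) _
      (fun ω => (norm_fourierWeight M y ω).le) fun h => by
        simpa only [add_zero] using (memLp_fourierWeight_mul_comp M y h).coeFn_toLp
  -- Both sides are continuous in `f` for the `L²` norm, so Schwartz functions suffice.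
  refine DenseRange.induction_on
    (SchwartzMap.denseRange_toLpCLM (E := Plane) (F := ℂ) (p := 2) (μ := volume)
      ENNReal.ofNat_ne_top) f
    (isClosed_eq (hcF.comp (continuous_dilate_translate M y)) (hcW.comp hcF)) fun s => ?_
  set u : SchwartzMap Plane ℂ := ((Real.sqrt (absDet M) : ℝ) : ℂ) •
    SchwartzMap.compCLMOfContinuousLinearEquiv ℂ (actEquiv M)
      (SchwartzMap.compSubConstCLM ℂ y s) with hu
  have hux : ∀ x, u x = ((Real.sqrt (absDet M) : ℝ) : ℂ) * s (act M x - y) := fun x => rfl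
  have h1 : dilate M (translate y (s.toLp 2)) = u.toLp 2 := by
    refine Lp.ext ?_
    have hq : Measure.QuasiMeasurePreserving (fun x => act M x - y) (volume : Measure Plane)
        volume := (measurePreserving_sub_right volume y).quasiMeasurePreserving.comp
      (quasiMeasurePreserving_act M)
    filter_upwards [dilate_translate_ae_eq M y (s.toLp 2), u.coeFn_toLp 2,
      hq.ae_eq_comp (s.coeFn_toLp 2)] with x e1 e2 e3
    simp only [Function.comp_apply] at e3
    rw [e1, e2, e3, hux]
  change (𝓕 (dilate M (translate y (s.toLp 2))) : L2) =
    (memLp_fourierWeight_mul_comp M y (𝓕 (s.toLp 2) : L2)).toLp _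
  rw [h1, SchwartzMap.toLp_fourier_eq]
  refine Lp.ext ?_
  filter_upwards [(𝓕 u).coeFn_toLp 2,
    (memLp_fourierWeight_mul_comp M y (𝓕 (s.toLp 2) : L2)).coeFn_toLp,
    (quasiMeasurePreserving_act (sharp M)).ae_eq_comp ((𝓕 s).coeFn_toLp 2)] with ω e1 e2 e3
  simp only [Function.comp_apply] at e3
  rw [e1, e2, SchwartzMap.toLp_fourier_eq, e3, SchwartzMap.fourier_coe, SchwartzMap.fourier_coe,
    ← fourier_schwartz_comp, Real.fourier_eq]
  simp only [hux]

/-! ### The analysis operator of one layer -/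

theorem fourierChar_inner_intVec (n : Fin 2 → ℤ) (x : Fin 2 → ℝ) :
    (Real.fourierChar ⟪(WithLp.toLp 2 (intVec n) : Plane), WithLp.toLp 2 x⟫_ℝ : ℂ) =
      UnitAddTorus.mFourier n (fun i => (x i : UnitAddCircle)) := by
  simp only [UnitAddTorus.mFourier, ContinuousMap.coe_mk, Fin.prod_univ_two, fourier_coe_apply,
    ← Complex.exp_add, Real.fourierChar_apply, PiLp.inner_apply, Fin.sum_univ_two, intVec]
  congr 1
  simp only [RCLike.inner_apply, conj_trivial]
  push_cast
  ring

/-- Plancherel exhibits the coefficients of a layer as integrals of one fixed function against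
characters; a representative `g` of `𝓕 f` is kept free so that a continuous one can be used. -/
theorem inner_dilate_translate (M : GL2) (y : Plane) (ψ f : L2) {g : Plane → ℂ}
    (hg : (𝓕 f : L2) =ᵐ[volume] g) :
    ⟪dilate M (translate y ψ), f⟫_ℂ = (((Real.sqrt (absDet M))⁻¹ : ℝ) : ℂ) *
      ∫ ω, (Real.fourierChar ⟪y, act (sharp M) ω⟫_ℝ : ℂ) *
        (conj ((𝓕 ψ : L2) (act (sharp M) ω)) * g ω) := by
  rw [← Lp.inner_fourier_eq, L2.inner_def, ← integral_const_mul]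
  refine integral_congr_ae ?_
  filter_upwards [hg, fourier_dilate_translate M y ψ] with ω h1 h2
  rw [h1, h2, RCLike.inner_apply, fourierWeight, map_mul, map_mul, Complex.conj_ofReal,
    ← Circle.coe_inv_eq_conj, AddChar.map_neg_eq_inv, inv_inv]
  ring

theorem integral_eq_absDet_smul (B : GL2) {E : Type*} [NormedAddCommGroup E] [NormedSpace ℝ E]
    (F : Plane → E) :
    ∫ ω, F ω = absDet B • ∫ x : Fin 2 → ℝ, F (act B (WithLp.toLp 2 x)) := by
  have h := (PiLp.volume_preserving_toLp (Fin 2)).integral_comp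
    (MeasurableEquiv.toLp 2 (Fin 2 → ℝ)).measurableEmbedding (fun ω => F (act B ω))
  rw [h, integral_comp_act B F, smul_smul, mul_inv_cancel₀ (absDet_pos B).ne', one_smul]

theorem finite_setOf_norm_intVec_le (R : ℝ) : {m : Fin 2 → ℤ | ‖intVec m‖ ≤ R}.Finite := by
  obtain ⟨N, hN⟩ := exists_nat_ge R
  refine (Set.finite_Icc (fun _ : Fin 2 => -(N : ℤ)) (fun _ => (N : ℤ))).subset fun m hm => ?_
  have h2 : ∀ i, |(m i : ℝ)| ≤ N := fun i => ((norm_le_pi_norm (intVec m) i).trans hm).trans hN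
  refine ⟨fun i => ?_, fun i => ?_⟩
  · have := (abs_le.1 (h2 i)).1
    exact_mod_cast this
  · have := (abs_le.1 (h2 i)).2
    exact_mod_cast this

theorem exists_norm_ofLp_act_inv_le (B : GL2) {Q : Set Plane} (hQ : IsCompact Q) :
    ∃ R, ∀ x : Fin 2 → ℝ, act B (WithLp.toLp 2 x) ∈ Q → ‖x‖ ≤ R := by
  have hb : Bornology.IsBounded ((fun ω : Plane => WithLp.ofLp (act B⁻¹ ω)) '' Q) :=
    (hQ.image ((PiLp.continuous_ofLp 2 _).comp (continuous_act B⁻¹))).isBounded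
  obtain ⟨R, hR⟩ := hb.exists_norm_le
  refine ⟨R, fun x hx => ?_⟩
  have h1 := hR _ ⟨_, hx, rfl⟩
  simpa only [act_inv_act] using h1

theorem finite_setOf_exists_unitCube (B : GL2) {Q : Set Plane} (hQ : IsCompact Q) :
    {m : Fin 2 → ℤ | ∃ x ∈ unitCube (Fin 2), act B (WithLp.toLp 2 (x + intVec m)) ∈ Q}.Finite := by
  obtain ⟨R, hR⟩ := exists_norm_ofLp_act_inv_le B hQ
  refine (finite_setOf_norm_intVec_le (R + 1)).subset ?_
  rintro m ⟨x, hx, hxQ⟩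
  have h1 : ‖x‖ ≤ 1 := by
    refine (pi_norm_le_iff_of_nonneg zero_le_one).2 fun i => ?_
    have := hx i
    rw [zero_add] at this
    rw [Real.norm_eq_abs, abs_of_pos this.1]
    exact this.2
  calc ‖intVec m‖ = ‖(x + intVec m) - x‖ := by rw [add_sub_cancel_left]
    _ ≤ ‖x + intVec m‖ + ‖x‖ := norm_sub_le _ _
    _ ≤ R + 1 := add_le_add (hR _ hxQ) h1

/-- As `(sharp M)⁻¹` is `Mᵀ`, this parametrizes the annihilator `MᵀΓ*` by integer vectors through
the matrix `MᵀC♯`. -/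
theorem mem_dualLattice_iff (C M : GL2) (α : Plane) :
    act (sharp M) α ∈ dualLattice C ↔
      α ∈ Set.range fun n : Fin 2 → ℤ => act ((sharp M)⁻¹ * sharp C) (WithLp.toLp 2 (intVec n)) := by
  constructor
  · rintro ⟨n, hn⟩
    refine ⟨n, ?_⟩
    change act (sharp C) (WithLp.toLp 2 (intVec n)) = _ at hn
    simp only [act_mul_apply, hn, act_inv_act]
  · rintro ⟨n, rfl⟩
    refine ⟨n, ?_⟩
    simp only [act_mul_apply, act_act_inv]
    rfl

open Classical in
/-- Parseval's identity for one layer `{D_M T_γ ψ}` of the system, tested on a function whose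
Fourier transform is continuous with compact support. -/
theorem hasSum_sq_inner_layer (C M : GL2) (ψ f : L2) {g : Plane → ℂ} (hgc : Continuous g)
    (hgs : HasCompactSupport g) (hg : (𝓕 f : L2) =ᵐ[volume] g) (E : Finset Plane)
    (hE : ∀ α ω, act (sharp M) α ∈ dualLattice C → g ω * conj (g (ω + α)) ≠ 0 → α ∈ E) :
    HasSum (fun n : Fin 2 → ℤ =>
      ((‖⟪dilate M (translate (act C (WithLp.toLp 2 (intVec n))) ψ), f⟫_ℂ‖ ^ 2 : ℝ) : ℂ))
      (((absDet C)⁻¹ : ℝ) * ∑ α ∈ E, if act (sharp M) α ∈ dualLattice C then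
        ∫ ω, g ω * conj (g (ω + α)) * conj ((𝓕 ψ : L2) (act (sharp M) ω) *
          conj ((𝓕 ψ : L2) (act (sharp M) (ω + α)))) else 0) := by
  -- In the coordinates `ω = Bx` the annihilator becomes `ℤ²`, and for `γ = Cn` the pairing `⟨γ,
  -- M♯ω⟩` becomes `⟨n, x⟩`.
  set B : GL2 := (sharp M)⁻¹ * sharp C with hB
  set K : Plane → ℂ := fun ω => conj ((𝓕 ψ : L2) (act (sharp M) ω)) * g ω with hK
  set H : (Fin 2 → ℝ) → ℂ := fun x => K (act B (WithLp.toLp 2 x)) with hH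
  have hdetB : absDet B = absDet M * (absDet C)⁻¹ := by
    rw [hB, absDet_mul, ← sharp_inv, absDet_sharp, absDet_sharp, absDet_inv, inv_inv]
  have hc2 : MemLp (fun ω => conj ((𝓕 ψ : L2) (act (sharp M) ω))) 2 volume :=
    (memLp_comp_act (Lp.memLp (𝓕 ψ : L2)) (sharp M)).star
  have hg2 : MemLp g 2 volume := hgc.memLp_of_hasCompactSupport hgs
  have hKm : Measurable K :=
    (Complex.continuous_conj.measurable.comp ((Lp.stronglyMeasurable _).measurable.comp
      (continuous_act (sharp M)).measurable)).mul hgc.measurable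
  obtain ⟨k0, hk0⟩ := hgs.exists_bound_of_continuous hgc
  have hK2 : MemLp K 2 volume :=
    hc2.of_le_mul (c := k0) hKm.aestronglyMeasurable (Filter.Eventually.of_forall fun ω => by
      rw [hK, norm_mul, mul_comm]
      exact mul_le_mul_of_nonneg_right (hk0 ω) (norm_nonneg _))
  have hK1 : Integrable K := hc2.integrable_mul hg2
  have hpres := PiLp.volume_preserving_toLp (Fin 2)
  have hH2 : MemLp H 2 volume := (memLp_comp_act hK2 B).comp_measurePreserving hpres
  have hH1 : Integrable H := by
    have h1 := memLp_comp_act (memLp_one_iff_integrable.2 hK1) B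
    exact memLp_one_iff_integrable.1 (h1.comp_measurePreserving hpres)
  have hHm : Measurable H := hKm.comp ((continuous_act B).measurable.comp hpres.measurable)
  have hinj : Function.Injective fun n : Fin 2 → ℤ => act B (WithLp.toLp 2 (intVec n)) := by
    intro m n hmn
    have h1 := WithLp.toLp_injective 2 (act_injective B hmn)
    ext i
    exact Int.cast_injective (congrFun h1 i)
  set T : Finset (Fin 2 → ℤ) := (finite_setOf_exists_unitCube B hgs).toFinset with hT
  have hTz : ∀ x ∈ unitCube (Fin 2), ∀ m ∉ T, H (x + intVec m) = 0 := by
    intro x hx m hm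
    by_contra hne
    refine hm ((Set.Finite.mem_toFinset _).2 ⟨x, hx, subset_tsupport _ ?_⟩)
    exact right_ne_zero_of_mul hne
  set S : Finset (Fin 2 → ℤ) := E.preimage _ hinj.injOn with hS
  have hSz : ∀ x, ∀ m ∉ S, H x * conj (H (x + intVec m)) = 0 := by
    intro x m hm
    by_contra hne
    refine hm (Finset.mem_preimage.2 (hE _ (act B (WithLp.toLp 2 x)) ?_ ?_))
    · exact (mem_dualLattice_iff C M _).2 ⟨m, rfl⟩
    · rw [← map_add, ← WithLp.toLp_add]
      refine mul_ne_zero (right_ne_zero_of_mul (left_ne_zero_of_mul hne)) fun h0 => ?_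
      refine right_ne_zero_of_mul hne ?_
      simp only [hH, hK, map_mul, h0, mul_zero]
  have hmain := hasSum_sq_integral_mFourier hH2 hHm hH1 T hTz S hSz
  -- Fourier coefficients use the character of index `-n`, whereas the inner products carry index
  -- `n`.
  have hmain' := ((Equiv.neg (Fin 2 → ℤ)).hasSum_iff).2 hmain
  -- `|det M|⁻¹` is the squared normalization and `|det B|²` the squared Jacobian of `ω = Bx`.
  -- Returning to the plane on the other side costs `|det B|⁻¹`, and `|det M|⁻¹ |det B| = |det C|⁻¹`
  -- remains.
  have hfac := hmain'.mul_left ((((absDet M)⁻¹ * absDet B ^ 2 : ℝ)) : ℂ)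
  convert! hfac using 1
  · ext n
    simp only [Function.comp_apply, Equiv.neg_apply, neg_neg]
    rw [inner_dilate_translate M _ ψ f hg, integral_eq_absDet_smul B]
    have e1 : ∀ x : Fin 2 → ℝ,
        (Real.fourierChar ⟪act C (WithLp.toLp 2 (intVec n)),
          act (sharp M) (act B (WithLp.toLp 2 x))⟫_ℝ : ℂ) =
        UnitAddTorus.mFourier n (fun i => (x i : UnitAddCircle)) := by
      intro x
      rw [hB, act_mul_apply, act_act_inv, inner_act_sharp, fourierChar_inner_intVec]
    simp only [e1]
    rw [← Complex.ofReal_mul]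
    congr 1
    rw [norm_mul, norm_smul, Complex.norm_real, Real.norm_eq_abs, Real.norm_eq_abs,
      abs_of_pos (absDet_pos B), abs_of_nonneg (by positivity), mul_pow, mul_pow, inv_pow,
      Real.sq_sqrt (absDet_pos M).le, mul_assoc]
  · set G : Plane → ℂ := fun α => if act (sharp M) α ∈ dualLattice C then
        (absDet B)⁻¹ • ∫ ω, g ω * conj (g (ω + α)) * conj ((𝓕 ψ : L2) (act (sharp M) ω) *
          conj ((𝓕 ψ : L2) (act (sharp M) (ω + α)))) else 0 with hG
    have e2 : ∀ m : Fin 2 → ℤ, ∫ x, H x * conj (H (x + intVec m)) =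
        G (act B (WithLp.toLp 2 (intVec m))) := by
      intro m
      simp only [hG]
      rw [if_pos ((mem_dualLattice_iff C M _).2 ⟨m, rfl⟩), integral_eq_absDet_smul B, smul_smul,
        inv_mul_cancel₀ (absDet_pos B).ne', one_smul]
      refine integral_congr_ae (Filter.Eventually.of_forall fun x => ?_)
      simp only [hH, hK, WithLp.toLp_add, map_add, map_mul, Complex.conj_conj]
      ring
    have e3 : ∑ m ∈ S, ∫ x, H x * conj (H (x + intVec m)) = ∑ α ∈ E, G α :=
      (Finset.sum_congr rfl fun m _ => e2 m).trans
        (Finset.sum_preimage (fun n : Fin 2 → ℤ => act B (WithLp.toLp 2 (intVec n))) E hinj.injOn G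
          fun α _ hα => if_neg fun h => hα ((mem_dualLattice_iff C M α).1 h))
    rw [e3, Finset.mul_sum, Finset.mul_sum]
    refine Finset.sum_congr rfl fun α _ => ?_
    simp only [hG]
    split_ifs with h
    · rw [Complex.real_smul, ← mul_assoc, ← Complex.ofReal_mul]
      congr 2
      have h1 := (absDet_pos M).ne'
      have h2 := (absDet_pos C).ne'
      rw [hdetB]
      field_simp
    · simp

/-! ### Layered systems `{D_{M_p} T_γ ψ_p}` over a lattice -/

theorem neg_mem_dualLattice {C : GL2} {α : Plane} (h : α ∈ dualLattice C) :
    -α ∈ dualLattice C := by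
  obtain ⟨n, rfl⟩ := h
  refine ⟨-n, ?_⟩
  simp only [← map_neg, ← WithLp.toLp_neg]
  congr 2
  ext i
  simp

theorem zero_mem_dualLattice (C : GL2) : (0 : Plane) ∈ dualLattice C := by
  refine ⟨0, ?_⟩
  have : (WithLp.toLp 2 fun i : Fin 2 => (((0 : Fin 2 → ℤ) i : ℤ) : ℝ)) = 0 := by
    ext i
    simp
  exact (congrArg (act (sharp C)) this).trans (map_zero _)

/-- The profile `ω ↦ 𝓕 ψ (M♯ ω)` of a layer on the Fourier side. -/
def profile (M : GL2) (ψ : L2) (ω : Plane) : ℂ := (𝓕 ψ : L2) (act (sharp M) ω)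

theorem measurable_profile (M : GL2) (ψ : L2) : Measurable (profile M ψ) :=
  (Lp.stronglyMeasurable _).measurable.comp (continuous_act (sharp M)).measurable

theorem memLp_profile (M : GL2) (ψ : L2) : MemLp (profile M ψ) 2 volume :=
  memLp_comp_act (Lp.memLp (𝓕 ψ : L2)) (sharp M)

theorem integrable_profile_mul_conj (M : GL2) (ψ : L2) (α : Plane) :
    Integrable fun ω => profile M ψ ω * conj (profile M ψ (ω + α)) :=
  (memLp_profile M ψ).integrable_mul (memLp_comp_add_right (memLp_profile M ψ) α).star

section Layers

variable {P : Type*} (C : GL2) (M : P → GL2) (ψ : P → L2)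

/-- The element `D_{M_p} T_{Cn} ψ_p` of a layered system. -/
def layerSystem (p : P × (Fin 2 → ℤ)) : L2 :=
  dilate (M p.1) (translate (act C (WithLp.toLp 2 (intVec p.2))) (ψ p.1))

/-- The layers whose annihilator contains `α`. -/
def layerKappa (α : Plane) : Set P := {p | act (sharp (M p)) α ∈ dualLattice C}

/-- The Calderón sum of a layered system. -/
def calderonSum (ω : Plane) : ℝ≥0∞ :=
  ENNReal.ofReal (absDet C)⁻¹ * ∑' p, ‖profile (M p) (ψ p) ω‖ₑ ^ 2

/-- The auto-correlation functions of a layered system. -/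
def autoCorr (α ω : Plane) : ℂ :=
  ((absDet C)⁻¹ : ℝ) * ∑' p : ↥(layerKappa C M α),
    profile (M p) (ψ p) ω * conj (profile (M p) (ψ p) (ω + α))

/-- Every bounded set meets all but finitely many of the annihilators at most in `0`, and meets
each of them in a finite set. -/
def LocallyFinite : Prop :=
  ∀ R : ℝ, {q : P × Plane | q.2 ≠ 0 ∧ ‖q.2‖ ≤ R ∧ q.1 ∈ layerKappa C M q.2}.Finite

variable {C M ψ}

theorem measurable_calderonSum [Countable P] : Measurable (calderonSum C M ψ) :=
  (Measurable.tsum fun p => ((measurable_profile (M p) (ψ p)).enorm.pow_const 2)).const_mul _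

theorem layerKappa_neg (α : Plane) : layerKappa C M (-α) = layerKappa C M α := by
  ext p
  simp only [layerKappa, Set.mem_ofPred_eq, map_neg]
  exact ⟨fun h => by simpa using neg_mem_dualLattice h, neg_mem_dualLattice⟩

open Classical in
theorem autoCorr_eq_sum {F : Finset P} {α : Plane} (hF : layerKappa C M α ⊆ F) (ω : Plane) :
    autoCorr C M ψ α ω = ((absDet C)⁻¹ : ℝ) * ∑ p ∈ F, if p ∈ layerKappa C M α then
      profile (M p) (ψ p) ω * conj (profile (M p) (ψ p) (ω + α)) else 0 := by
  rw [autoCorr, tsum_subtype (layerKappa C M α)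
    (fun p => profile (M p) (ψ p) ω * conj (profile (M p) (ψ p) (ω + α))), tsum_eq_sum (s := F)]
  · rfl
  · intro p hp
    exact Set.indicator_of_notMem (fun h => hp (hF h)) _

/-- Shifting by `α` exchanges the two factors of each term, so the two functions are complex
conjugates; the annihilators are symmetric, so both sums run over the same layers. -/
theorem norm_autoCorr_sub (α ω : Plane) :
    ‖autoCorr C M ψ α (ω - α)‖ = ‖autoCorr C M ψ (-α) ω‖ := by
  rw [← RCLike.norm_conj (autoCorr C M ψ (-α) ω), autoCorr, autoCorr, layerKappa_neg, map_mul,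
    Complex.conj_ofReal, Complex.conj_tsum]
  simp only [map_mul, Complex.conj_conj, sub_add_cancel, ← sub_eq_add_neg, mul_comm]

theorem LocallyFinite.finite_layerKappa (h : LocallyFinite C M) {α : Plane} (hα : α ≠ 0) :
    (layerKappa C M α).Finite := by
  refine ((h ‖α‖).image Prod.fst).subset fun p hp => ⟨(p, α), ⟨hα, le_rfl, hp⟩, rfl⟩

theorem LocallyFinite.integrable_autoCorr (h : LocallyFinite C M) {α : Plane} (hα : α ≠ 0) :
    Integrable (autoCorr C M ψ α) := by
  classical
  have h1 : autoCorr C M ψ α = fun ω => ((absDet C)⁻¹ : ℝ) *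
      ∑ p ∈ (h.finite_layerKappa hα).toFinset, if p ∈ layerKappa C M α then
        profile (M p) (ψ p) ω * conj (profile (M p) (ψ p) (ω + α)) else 0 := by
    ext ω
    exact autoCorr_eq_sum (by simp) ω
  rw [h1]
  refine (integrable_finsetSum _ fun p _ => ?_).const_mul _
  split_ifs
  · exact integrable_profile_mul_conj _ _ _
  · exact integrable_zero _ _ _

theorem norm_sq_eq_integral {f : L2} {g : Plane → ℂ} (hg : (𝓕 f : L2) =ᵐ[volume] g) :
    ‖f‖ ^ 2 = ∫ ω, ‖g ω‖ ^ 2 := by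
  have h : ((‖f‖ ^ 2 : ℝ) : ℂ) = ((∫ ω, ‖g ω‖ ^ 2 : ℝ) : ℂ) := by
    rw [← Lp.norm_fourier_eq f, Complex.ofReal_pow, ← Complex.coe_algebraMap,
      ← inner_self_eq_norm_sq_to_K (𝕜 := ℂ), L2.inner_def]
    change _ = ((∫ ω, ‖g ω‖ ^ 2 : ℝ) : ℂ)
    rw [← integral_complex_ofReal]
    refine integral_congr_ae ?_
    filter_upwards [hg] with ω h
    rw [h, inner_self_eq_norm_sq_to_K]
    simp
  exact_mod_cast h

theorem integrable_bounded_mul {g : Plane → ℂ} (hgc : Continuous g) (hgs : HasCompactSupport g)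
    {α : Plane} {u : Plane → ℂ} (hu : Integrable u) :
    Integrable fun ω => g ω * conj (g (ω + α)) * u ω := by
  obtain ⟨k, hk⟩ := hgs.exists_bound_of_continuous hgc
  refine hu.bdd_mul (c := k * k) (by fun_prop) (Filter.Eventually.of_forall fun ω => ?_)
  rw [norm_mul, RCLike.norm_conj]
  exact mul_le_mul (hk _) (hk _) (norm_nonneg _) ((norm_nonneg _).trans (hk ω))

theorem integrable_normSq_mul {g : Plane → ℂ} (hgc : Continuous g) (hgs : HasCompactSupport g)
    (α : Plane) {u : Plane → ℂ} (hu : Integrable u) :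
    Integrable fun ω => ‖g (ω + α)‖ ^ 2 * ‖u ω‖ := by
  obtain ⟨k, hk⟩ := hgs.exists_bound_of_continuous hgc
  refine hu.norm.bdd_mul (c := k ^ 2) (by fun_prop) (Filter.Eventually.of_forall fun ω => ?_)
  rw [norm_pow, norm_norm]
  exact pow_le_pow_left₀ (norm_nonneg _) (hk _) 2

/-- The off-diagonal part of the frame operator is controlled by the sum of the moduli of the
auto-correlation functions. -/
theorem norm_sum_integral_autoCorr_le (h : LocallyFinite C M) {g : Plane → ℂ}
    (hgc : Continuous g) (hgs : HasCompactSupport g) {E : Finset Plane}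
    (hE0 : ∀ α ∈ E, α ≠ 0) (hEneg : ∀ α ∈ E, -α ∈ E) :
    ‖∑ α ∈ E, ∫ ω, g ω * conj (g (ω + α)) * conj (autoCorr C M ψ α ω)‖ ≤
      ∑ α ∈ E, ∫ ω, ‖g ω‖ ^ 2 * ‖autoCorr C M ψ α ω‖ := by
  have hT : ∀ α ∈ E, Integrable (autoCorr C M ψ α) := fun α hα => h.integrable_autoCorr (hE0 α hα)
  have h0 : ∀ α ∈ E, Integrable fun ω => ‖g ω‖ ^ 2 * ‖autoCorr C M ψ α ω‖ := fun α hα => by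
    simpa using integrable_normSq_mul hgc hgs 0 (hT α hα)
  have h1 : ∀ α ∈ E, ‖∫ ω, g ω * conj (g (ω + α)) * conj (autoCorr C M ψ α ω)‖ ≤
      2⁻¹ * (∫ ω, ‖g ω‖ ^ 2 * ‖autoCorr C M ψ α ω‖) +
        2⁻¹ * ∫ ω, ‖g ω‖ ^ 2 * ‖autoCorr C M ψ (-α) ω‖ := by
    intro α hα
    have e1 : ∫ ω, ‖g (ω + α)‖ ^ 2 * ‖autoCorr C M ψ α ω‖ =
        ∫ ω, ‖g ω‖ ^ 2 * ‖autoCorr C M ψ (-α) ω‖ := by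
      rw [← integral_sub_right_eq_self _ α]
      simp only [sub_add_cancel, norm_autoCorr_sub]
    rw [← e1, ← integral_const_mul, ← integral_const_mul,
      ← integral_add ((h0 α hα).const_mul _)
        ((integrable_normSq_mul hgc hgs α (hT α hα)).const_mul _)]
    refine norm_integral_le_of_norm_le (((h0 α hα).const_mul _).add
        ((integrable_normSq_mul hgc hgs α (hT α hα)).const_mul _))
      (Filter.Eventually.of_forall fun ω => ?_)
    simp only [norm_mul, RCLike.norm_conj]
    -- This is `2|xy| ≤ |x|² + |y|²` for `x = g ω`, `y = g (ω + α)`, weighted by the modulus of the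
    -- auto-correlation.
    nlinarith [mul_nonneg (sq_nonneg (‖g ω‖ - ‖g (ω + α)‖)) (norm_nonneg (autoCorr C M ψ α ω))]
  refine (norm_sum_le _ _).trans ((Finset.sum_le_sum h1).trans (le_of_eq ?_))
  rw [Finset.sum_add_distrib, ← Finset.mul_sum, ← Finset.mul_sum]
  -- As `E` is symmetric, the two halves are equal.
  have h2 : ∑ α ∈ E, ∫ ω, ‖g ω‖ ^ 2 * ‖autoCorr C M ψ (-α) ω‖ =
      ∑ α ∈ E, ∫ ω, ‖g ω‖ ^ 2 * ‖autoCorr C M ψ α ω‖ :=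
    Finset.sum_nbij' (fun α => -α) (fun α => -α) hEneg hEneg (fun _ _ => neg_neg _)
      (fun _ _ => neg_neg _) fun _ _ => rfl
  rw [h2]
  ring

/-- The diagonal part of the frame operator is given by the Calderón sum. -/
theorem hasSum_integral_calderonSum [Countable P] {b : ℝ} {g : Plane → ℂ} (hgc : Continuous g)
    (hgs : HasCompactSupport g) (hb : ∀ᵐ ω, calderonSum C M ψ ω ≤ ENNReal.ofReal b) :
    HasSum (fun p => (absDet C)⁻¹ * ∫ ω, ‖g ω‖ ^ 2 * ‖profile (M p) (ψ p) ω‖ ^ 2)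
        (∫ ω, ‖g ω‖ ^ 2 * (calderonSum C M ψ ω).toReal) ∧
      Integrable fun ω => ‖g ω‖ ^ 2 * (calderonSum C M ψ ω).toReal := by
  have hC : 0 < (absDet C)⁻¹ := inv_pos.2 (absDet_pos C)
  have hg2 : Integrable fun ω => ‖g ω‖ ^ 2 :=
    (memLp_two_iff_integrable_sq_norm hgc.aestronglyMeasurable).1
      (hgc.memLp_of_hasCompactSupport hgs)
  have hint : Integrable fun ω => ‖g ω‖ ^ 2 * (calderonSum C M ψ ω).toReal := by
    -- The sign of `b` is not known here, and `max b 0` is the real value of `ENNReal.ofReal b`.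
    refine (hg2.mul_const (max b 0)).mono'
      ((hgc.norm.pow 2).measurable.mul measurable_calderonSum.ennreal_toReal).aestronglyMeasurable ?_
    filter_upwards [hb] with ω h
    rw [Real.norm_eq_abs, abs_of_nonneg (by positivity)]
    refine mul_le_mul_of_nonneg_left ?_ (by positivity)
    rw [← ENNReal.toReal_ofReal']
    exact ENNReal.toReal_mono ENNReal.ofReal_ne_top h
  have hpt : ∀ᵐ ω, HasSum (fun p => (absDet C)⁻¹ * (‖g ω‖ ^ 2 * ‖profile (M p) (ψ p) ω‖ ^ 2))
      (‖g ω‖ ^ 2 * (calderonSum C M ψ ω).toReal) := by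
    filter_upwards [hb] with ω h
    have h1 : ∑' p, ‖profile (M p) (ψ p) ω‖ₑ ^ 2 ≠ ⊤ := by
      intro htop
      rw [calderonSum, htop, ENNReal.mul_top (by simpa using hC)] at h
      exact absurd h (by simp)
    have h2 := (ENNReal.summable_toReal h1).hasSum
    rw [← ENNReal.tsum_toReal_eq (fun p => ENNReal.ne_top_of_tsum_ne_top h1 p)] at h2
    have h3 := h2.mul_left (‖g ω‖ ^ 2 * (absDet C)⁻¹)
    convert! h3 using 1
    · ext p
      rw [ENNReal.toReal_pow, toReal_enorm]
      ring
    · rw [calderonSum, ENNReal.toReal_mul, ENNReal.toReal_ofReal hC.le]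
      ring
  refine ⟨?_, hint⟩
  simp_rw [← integral_const_mul]
  -- The terms are non-negative and serve as their own bound; their sum is integrable by `hint`.
  refine hasSum_integral_of_dominated_convergence
    (fun p ω => (absDet C)⁻¹ * (‖g ω‖ ^ 2 * ‖profile (M p) (ψ p) ω‖ ^ 2)) (fun p => ?_)
    (fun p => Filter.Eventually.of_forall fun ω => ?_) ?_ ?_ hpt
  · exact (((hgc.norm.pow 2).measurable.mul
      ((measurable_profile _ _).norm.pow_const 2)).const_mul _).aestronglyMeasurable
  · rw [Real.norm_eq_abs, abs_of_nonneg (by positivity)]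
  · filter_upwards [hpt] with ω h using h.summable
  · refine hint.congr ?_
    filter_upwards [hpt] with ω h using h.tsum_eq.symm

end Layers

section Layers

variable {P : Type*} {C : GL2} {M : P → GL2} {ψ : P → L2}

/-- The frame operator of a layered system, tested on a function whose Fourier transform is
continuous with compact support, is the Calderón sum plus finitely many auto-correlation terms. -/
theorem exists_hasSum_sq_inner_layerSystem [Countable P] (h : LocallyFinite C M) {b : ℝ}
    (hb : ∀ᵐ ω, calderonSum C M ψ ω ≤ ENNReal.ofReal b) {f : L2} {g : Plane → ℂ}
    (hgc : Continuous g) (hgs : HasCompactSupport g) (hg : (𝓕 f : L2) =ᵐ[volume] g) :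
    ∃ (E : Finset Plane) (W : ℝ), (∀ α ∈ E, α ≠ 0 ∧ (layerKappa C M α).Nonempty) ∧
      (∀ α ∈ E, -α ∈ E) ∧
      HasSum (fun p => ‖⟪layerSystem C M ψ p, f⟫_ℂ‖ ^ 2) W ∧
      (W : ℂ) = ((∫ ω, ‖g ω‖ ^ 2 * (calderonSum C M ψ ω).toReal : ℝ) : ℂ) +
        ∑ α ∈ E, ∫ ω, g ω * conj (g (ω + α)) * conj (autoCorr C M ψ α ω) := by
  classical
  obtain ⟨R, hR⟩ := (show IsCompact (tsupport g) from hgs).isBounded.exists_norm_le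
  have hgR : ∀ ω, g ω ≠ 0 → ‖ω‖ ≤ R := fun ω hω => hR ω (subset_tsupport _ hω)
  -- If `g ω` and `g (ω + α)` are both non-zero then `‖α‖ ≤ 2R`. Local finiteness leaves finitely
  -- many pairs of a layer and a shift; `E` collects the shifts and `F` the layers.
  set Q := (h (2 * R)).toFinset with hQ
  have hQmem : ∀ p α, (p, α) ∈ Q ↔ α ≠ 0 ∧ ‖α‖ ≤ 2 * R ∧ p ∈ layerKappa C M α := fun p α => by
    simp [hQ]
  set E := Q.image Prod.snd with hE
  set F := Q.image Prod.fst with hF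
  have hE0 : ∀ α ∈ E, α ≠ 0 ∧ ‖α‖ ≤ 2 * R ∧ (layerKappa C M α).Nonempty := by
    intro α hα
    obtain ⟨⟨p, β⟩, hq, rfl⟩ := Finset.mem_image.1 hα
    have := (hQmem p β).1 hq
    exact ⟨this.1, this.2.1, p, this.2.2⟩
  have hmemE : ∀ p α, α ≠ 0 → ‖α‖ ≤ 2 * R → p ∈ layerKappa C M α → α ∈ E ∧ p ∈ F :=
    fun p α h1 h2 h3 => ⟨Finset.mem_image.2 ⟨(p, α), (hQmem p α).2 ⟨h1, h2, h3⟩, rfl⟩,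
      Finset.mem_image.2 ⟨(p, α), (hQmem p α).2 ⟨h1, h2, h3⟩, rfl⟩⟩
  have h0E : (0 : Plane) ∉ E := fun h0 => (hE0 0 h0).1 rfl
  have hEneg : ∀ α ∈ E, -α ∈ E := by
    intro α hα
    obtain ⟨h1, h2, p, hp⟩ := hE0 α hα
    exact (hmemE p (-α) (neg_ne_zero.2 h1) (by rwa [norm_neg])
      (by rwa [layerKappa_neg])).1
  set I : P → ℝ := fun p => (absDet C)⁻¹ * ∫ ω, ‖g ω‖ ^ 2 * ‖profile (M p) (ψ p) ω‖ ^ 2 with hI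
  set X : P → Plane → Plane → ℂ := fun p α ω =>
    profile (M p) (ψ p) ω * conj (profile (M p) (ψ p) (ω + α)) with hX
  set r : P → ℂ := fun p => ((absDet C)⁻¹ : ℝ) * ∑ α ∈ E, if p ∈ layerKappa C M α then
    ∫ ω, g ω * conj (g (ω + α)) * conj (X p α ω) else 0 with hr
  have hlayer : ∀ p, HasSum (fun n : Fin 2 → ℤ =>
      ((‖⟪layerSystem C M ψ (p, n), f⟫_ℂ‖ ^ 2 : ℝ) : ℂ)) ((I p : ℂ) + r p) := by
    intro p
    -- The shift `0` lies in every annihilator and yields the diagonal term `I p`; the shifts in `E`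
    -- yield `r p`.
    have h1 := hasSum_sq_inner_layer C (M p) (ψ p) f hgc hgs hg (insert 0 E) (by
      intro α ω hα hne
      rw [Finset.mem_insert]
      by_cases hα0 : α = 0
      · exact Or.inl hα0
      refine Or.inr (hmemE p α hα0 ?_ hα).1
      have e1 := hgR ω (left_ne_zero_of_mul hne)
      have e2 := hgR (ω + α) fun e => right_ne_zero_of_mul hne (by rw [e, map_zero])
      calc ‖α‖ = ‖(ω + α) - ω‖ := by rw [add_sub_cancel_left]
        _ ≤ ‖ω + α‖ + ‖ω‖ := norm_sub_le _ _
        _ ≤ 2 * R := by linarith)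
    rw [Finset.sum_insert h0E, mul_add, map_zero, if_pos (zero_mem_dualLattice C)] at h1
    convert! h1 using 2
    rw [hI, Complex.ofReal_mul, ← integral_complex_ofReal]
    congr 1
    refine integral_congr_ae (Filter.Eventually.of_forall fun ω => ?_)
    simp only [add_zero, Complex.mul_conj', profile, map_pow, Complex.conj_ofReal]
    push_cast
    rfl
  have hlayer' : ∀ p, HasSum (fun n : Fin 2 → ℤ => ‖⟪layerSystem C M ψ (p, n), f⟫_ℂ‖ ^ 2)
      (∑' n : Fin 2 → ℤ, ‖⟪layerSystem C M ψ (p, n), f⟫_ℂ‖ ^ 2) := fun p =>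
    (Complex.hasSum_iff _ _ |>.1 (hlayer p)).1.summable.hasSum
  have hW : ∀ p, ((∑' n : Fin 2 → ℤ, ‖⟪layerSystem C M ψ (p, n), f⟫_ℂ‖ ^ 2 : ℝ) : ℂ) =
      (I p : ℂ) + r p := by
    intro p
    rw [Complex.ofReal_tsum]
    exact (hlayer p).tsum_eq
  -- Only finitely many layers have an off-diagonal part, so the sum over all layers splits into the
  -- Calderón series and a finite sum.
  have hr0 : ∀ p ∉ F, r p = 0 := by
    intro p hp
    rw [hr]
    simp only
    rw [Finset.sum_eq_zero, mul_zero]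
    intro α hα
    exact if_neg fun hk => hp (hmemE p α (hE0 α hα).1 (hE0 α hα).2.1 hk).2
  have hrsum : HasSum r (∑ p ∈ F, r p) := hasSum_sum_of_ne_finset_zero hr0
  have hIsum := (hasSum_integral_calderonSum hgc hgs hb).1
  have htot : HasSum (fun p => ((∑' n : Fin 2 → ℤ, ‖⟪layerSystem C M ψ (p, n), f⟫_ℂ‖ ^ 2 : ℝ) : ℂ))
      (((∫ ω, ‖g ω‖ ^ 2 * (calderonSum C M ψ ω).toReal : ℝ) : ℂ) + ∑ p ∈ F, r p) := by
    simp_rw [hW]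
    exact ((Complex.hasSum_ofReal).2 hIsum).add hrsum
  have htot' : Summable fun p => ∑' n : Fin 2 → ℤ, ‖⟪layerSystem C M ψ (p, n), f⟫_ℂ‖ ^ 2 :=
    (Complex.hasSum_iff _ _ |>.1 htot).1.summable
  have hsummable : Summable fun p => ‖⟪layerSystem C M ψ p, f⟫_ℂ‖ ^ 2 :=
    (summable_prod_of_nonneg fun p => by positivity).2 ⟨fun p => (hlayer' p).summable, htot'⟩
  refine ⟨E, _, fun α hα => ⟨(hE0 α hα).1, (hE0 α hα).2.2⟩, hEneg, hsummable.hasSum, ?_⟩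
  rw [hsummable.tsum_prod' fun p => (hlayer' p).summable, Complex.ofReal_tsum, htot.tsum_eq]
  congr 1
  rw [hr]
  simp only
  rw [← Finset.mul_sum, Finset.sum_comm, Finset.mul_sum]
  refine Finset.sum_congr rfl fun α hα => ?_
  have e1 : ∀ ω, g ω * conj (g (ω + α)) * conj (autoCorr C M ψ α ω) = ((absDet C)⁻¹ : ℝ) *
      ∑ p ∈ F, if p ∈ layerKappa C M α then g ω * conj (g (ω + α)) * conj (X p α ω) else 0 := by
    intro ω
    rw [autoCorr_eq_sum (F := F) (fun p hp => (hmemE p α (hE0 α hα).1 (hE0 α hα).2.1 hp).2),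
      map_mul, Complex.conj_ofReal, map_sum, mul_left_comm, Finset.mul_sum]
    congr 1
    refine Finset.sum_congr rfl fun p _ => ?_
    split_ifs <;> simp [hX]
  simp_rw [e1]
  rw [integral_const_mul, integral_finsetSum]
  · congr 1
    refine Finset.sum_congr rfl fun p _ => ?_
    split_ifs
    · rfl
    · simp
  · intro p _
    split_ifs
    · refine integrable_bounded_mul hgc hgs (u := fun ω => conj (X p α ω)) ?_
      exact Complex.conjCLE.toContinuousLinearMap.integrable_comp
        (integrable_profile_mul_conj (M p) (ψ p) α)
    · exact integrable_zero _ _ _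

/-- The frame inequalities on functions whose Fourier transform is continuous with compact
support. -/
theorem frame_inequalities_of_hasCompactSupport [Countable P] (h : LocallyFinite C M) {a b : ℝ}
    (hb : ∀ᵐ ω, calderonSum C M ψ ω ≤ ENNReal.ofReal b)
    (hab : ∀ᵐ ω, ∀ E : Finset Plane, (∀ α ∈ E, α ≠ 0 ∧ (layerKappa C M α).Nonempty) →
      (calderonSum C M ψ ω).toReal + ∑ α ∈ E, ‖autoCorr C M ψ α ω‖ ≤ b ∧
      a + ∑ α ∈ E, ‖autoCorr C M ψ α ω‖ ≤ (calderonSum C M ψ ω).toReal) {f : L2} {g : Plane → ℂ}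
    (hgc : Continuous g) (hgs : HasCompactSupport g) (hg : (𝓕 f : L2) =ᵐ[volume] g) :
    ∃ W : ℝ, HasSum (fun p => ‖⟪layerSystem C M ψ p, f⟫_ℂ‖ ^ 2) W ∧ a * ‖f‖ ^ 2 ≤ W ∧
      W ≤ b * ‖f‖ ^ 2 := by
  obtain ⟨E, W, hE, hEneg, hW, hWeq⟩ := exists_hasSum_sq_inner_layerSystem h hb hgc hgs hg
  refine ⟨W, hW, ?_⟩
  have hJ := (hasSum_integral_calderonSum hgc hgs hb).2
  have hT : ∀ α ∈ E, Integrable fun ω => ‖g ω‖ ^ 2 * ‖autoCorr C M ψ α ω‖ := fun α hα => by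
    simpa using integrable_normSq_mul hgc hgs 0 (h.integrable_autoCorr (ψ := ψ) (hE α hα).1)
  have hg2 : Integrable fun ω => ‖g ω‖ ^ 2 :=
    (memLp_two_iff_integrable_sq_norm hgc.aestronglyMeasurable).1
      (hgc.memLp_of_hasCompactSupport hgs)
  have hbound := norm_sum_integral_autoCorr_le (ψ := ψ) h hgc hgs (fun α hα => (hE α hα).1) hEneg
  -- The off-diagonal sum equals `W` minus the diagonal integral, hence is real, and the norm bound
  -- becomes a two-sided estimate for `W`.
  rw [← integral_finsetSum _ hT, eq_sub_iff_add_eq'.2 hWeq.symm, ← Complex.ofReal_sub,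
    Complex.norm_real, Real.norm_eq_abs, abs_le] at hbound
  have hS := integrable_finsetSum _ hT
  rw [norm_sq_eq_integral hg, ← integral_const_mul, ← integral_const_mul]
  constructor
  · have h1 : ∫ ω, a * ‖g ω‖ ^ 2 ≤ (∫ ω, ‖g ω‖ ^ 2 * (calderonSum C M ψ ω).toReal) -
        ∫ ω, ∑ α ∈ E, ‖g ω‖ ^ 2 * ‖autoCorr C M ψ α ω‖ := by
      rw [← integral_sub hJ hS]
      refine integral_mono_ae (hg2.const_mul _) (hJ.sub hS) ?_
      filter_upwards [hab] with ω hω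
      have := mul_le_mul_of_nonneg_left (hω E hE).2 (sq_nonneg ‖g ω‖)
      rw [← Finset.mul_sum]
      linarith
    linarith [hbound.1]
  · have h1 : (∫ ω, ‖g ω‖ ^ 2 * (calderonSum C M ψ ω).toReal) +
        ∫ ω, ∑ α ∈ E, ‖g ω‖ ^ 2 * ‖autoCorr C M ψ α ω‖ ≤ ∫ ω, b * ‖g ω‖ ^ 2 := by
      rw [← integral_add hJ hS]
      refine integral_mono_ae (hJ.add hS) (hg2.const_mul _) ?_
      filter_upwards [hab] with ω hω
      have := mul_le_mul_of_nonneg_left (hω E hE).1 (sq_nonneg ‖g ω‖)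
      rw [← Finset.mul_sum]
      linarith
    linarith [hbound.2]

end Layers

/-! ### Extension by density -/

/-- Continuous compactly supported functions are dense in `L²`, and the inverse Fourier transform is
an isometry. -/
theorem dense_hasCompactSupport_fourier :
    Dense {f : L2 | ∃ g : Plane → ℂ, Continuous g ∧ HasCompactSupport g ∧
      (𝓕 f : L2) =ᵐ[volume] g} := by
  rw [Metric.dense_iff]
  intro f ε hε
  obtain ⟨g, hgs, hgε, hgc, hg2⟩ := (Lp.memLp (𝓕 f : L2)).exists_hasCompactSupport_eLpNorm_sub_le
    (by norm_num) (ε := ENNReal.ofReal (ε / 2)) (by simpa using hε)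
  refine ⟨(Lp.fourierTransformₗᵢ Plane ℂ).symm (hg2.toLp g), ?_, g, hgc, hgs, ?_⟩
  · rw [Metric.mem_ball', ← (Lp.fourierTransformₗᵢ Plane ℂ).dist_map,
      LinearIsometryEquiv.apply_symm_apply, Lp.dist_def]
    have e1 : ((Lp.fourierTransformₗᵢ Plane ℂ f : L2) : Plane → ℂ) - ((hg2.toLp g : L2) : Plane → ℂ) =ᵐ[volume]
        ((𝓕 f : L2) : Plane → ℂ) - g := by
      filter_upwards [hg2.coeFn_toLp] with x hx
      simp only [Pi.sub_apply, hx]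
      rfl
    rw [eLpNorm_congr_ae e1]
    refine lt_of_le_of_lt (ENNReal.toReal_mono ENNReal.ofReal_ne_top hgε) ?_
    rw [ENNReal.toReal_ofReal (by positivity)]
    linarith
  · change ((Lp.fourierTransformₗᵢ Plane ℂ ((Lp.fourierTransformₗᵢ Plane ℂ).symm (hg2.toLp g)) : L2) :
      Plane → ℂ) =ᵐ[volume] g
    rw [LinearIsometryEquiv.apply_symm_apply]
    exact hg2.coeFn_toLp

/-- Frame inequalities extend from a dense set to the whole space. -/
theorem isFrameWithBounds_of_dense {ι : Type*} {u : ι → L2} {a b : ℝ} (ha : 0 < a) (hb : 0 < b)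
    {D : Set L2} (hD : Dense D)
    (h : ∀ f ∈ D, ∃ W : ℝ, HasSum (fun n => ‖⟪u n, f⟫_ℂ‖ ^ 2) W ∧ a * ‖f‖ ^ 2 ≤ W ∧
      W ≤ b * ‖f‖ ^ 2) :
    IsFrameWithBounds u a b := by
  -- A finite partial sum is continuous in `f`, so the upper bound passes to the closure before any
  -- summability is known.
  have hfin : ∀ (s : Finset ι) (f : L2), ∑ n ∈ s, ‖⟪u n, f⟫_ℂ‖ ^ 2 ≤ b * ‖f‖ ^ 2 := by
    intro s f
    have hcl : IsClosed {f : L2 | ∑ n ∈ s, ‖⟪u n, f⟫_ℂ‖ ^ 2 ≤ b * ‖f‖ ^ 2} :=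
      isClosed_le (by fun_prop) (by fun_prop)
    have hsub : D ⊆ {f : L2 | ∑ n ∈ s, ‖⟪u n, f⟫_ℂ‖ ^ 2 ≤ b * ‖f‖ ^ 2} := by
      intro f hf
      obtain ⟨W, hW, -, hWb⟩ := h f hf
      exact (sum_le_hasSum s (fun n _ => by positivity) hW).trans hWb
    exact hcl.closure_subset_iff.2 hsub (hD f)
  have hsum : ∀ f : L2, Summable fun n => ‖⟪u n, f⟫_ℂ‖ ^ 2 := fun f =>
    summable_of_sum_le (fun n => by positivity) fun s => hfin s f
  have hup : ∀ f : L2, ∑' n, ‖⟪u n, f⟫_ℂ‖ ^ 2 ≤ b * ‖f‖ ^ 2 := fun f =>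
    (hsum f).tsum_le_of_sum_le fun s => hfin s f
  refine ⟨ha, hb, fun f => ⟨hsum f, ?_, hup f⟩⟩
  set W := ∑' n, ‖⟪u n, f⟫_ℂ‖ ^ 2 with hW
  -- For the lower bound, compare `f` with `d ∈ D` through `(x + y)² ≤ (1+δ)x² + (1+δ⁻¹)y²`, control
  -- the error by the upper bound at `d - f`, let `d` tend to `f`, and only then let `δ` tend to
  -- `0`.
  have hδ : ∀ δ : ℝ, 0 < δ → a * ‖f‖ ^ 2 ≤ (1 + δ) * W := by
    intro δ hδ
    have hcl : IsClosed {d : L2 | a * ‖d‖ ^ 2 ≤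
        (1 + δ) * W + (1 + δ⁻¹) * (b * ‖d - f‖ ^ 2)} :=
      isClosed_le (by fun_prop) (by fun_prop)
    have hsub : D ⊆ {d : L2 | a * ‖d‖ ^ 2 ≤
        (1 + δ) * W + (1 + δ⁻¹) * (b * ‖d - f‖ ^ 2)} := by
      intro d hd
      obtain ⟨Wd, hWd, hWa, -⟩ := h d hd
      refine hWa.trans ?_
      have h1 : ∀ n, ‖⟪u n, d⟫_ℂ‖ ^ 2 ≤
          (1 + δ) * ‖⟪u n, f⟫_ℂ‖ ^ 2 + (1 + δ⁻¹) * ‖⟪u n, d - f⟫_ℂ‖ ^ 2 := by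
        intro n
        have e1 : ‖⟪u n, d⟫_ℂ‖ ≤ ‖⟪u n, f⟫_ℂ‖ + ‖⟪u n, d - f⟫_ℂ‖ := by
          rw [inner_sub_right]
          exact norm_le_norm_add_norm_sub' _ _
        set x := ‖⟪u n, f⟫_ℂ‖
        set y := ‖⟪u n, d - f⟫_ℂ‖
        have e2 : ‖⟪u n, d⟫_ℂ‖ ^ 2 ≤ (x + y) ^ 2 := pow_le_pow_left₀ (norm_nonneg _) e1 2
        have e3 : 0 ≤ δ⁻¹ * (δ * x - y) ^ 2 := by positivity
        have e4 : δ⁻¹ * (δ * x - y) ^ 2 = δ * x ^ 2 - 2 * x * y + δ⁻¹ * y ^ 2 := by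
          field_simp
          ring
        linarith
      have h2 := hWd.summable.tsum_le_tsum h1
        (((hsum f).mul_left (1 + δ)).add ((hsum (d - f)).mul_left (1 + δ⁻¹)))
      rw [hWd.tsum_eq, ((hsum f).mul_left (1 + δ)).tsum_add ((hsum (d - f)).mul_left (1 + δ⁻¹)),
        tsum_mul_left, tsum_mul_left] at h2
      have h3 := mul_le_mul_of_nonneg_left (hup (d - f)) (show 0 ≤ 1 + δ⁻¹ by positivity)
      linarith
    have := hcl.closure_subset_iff.2 hsub (hD f)
    simpa using this
  have hW0 : 0 ≤ W := tsum_nonneg fun n => by positivity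
  refine le_of_forall_pos_le_add fun ε hε => ?_
  -- Dividing by `W + 1` avoids a case distinction at `W = 0`.
  refine (hδ (ε / (W + 1)) (by positivity)).trans ?_
  have : ε / (W + 1) * W ≤ ε := by
    rw [div_mul_eq_mul_div, div_le_iff₀ (by positivity)]
    nlinarith
  linarith

/-- The frame estimate for layered systems with locally finite annihilators. -/
theorem isFrameWithBounds_layerSystem {P : Type*} [Countable P] {C : GL2} {M : P → GL2}
    {ψ : P → L2} (h : LocallyFinite C M) {a b : ℝ} (ha : 0 < a) (hb0 : 0 < b)
    (hb : ∀ᵐ ω, calderonSum C M ψ ω ≤ ENNReal.ofReal b)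
    (hab : ∀ᵐ ω, ∀ E : Finset Plane, (∀ α ∈ E, α ≠ 0 ∧ (layerKappa C M α).Nonempty) →
      (calderonSum C M ψ ω).toReal + ∑ α ∈ E, ‖autoCorr C M ψ α ω‖ ≤ b ∧
      a + ∑ α ∈ E, ‖autoCorr C M ψ α ω‖ ≤ (calderonSum C M ψ ω).toReal) :
    IsFrameWithBounds (layerSystem C M ψ) a b :=
  isFrameWithBounds_of_dense ha hb0 dense_hasCompactSupport_fourier fun _ ⟨_, hgc, hgs, hg⟩ =>
    frame_inequalities_of_hasCompactSupport h hb hab hgc hgs hg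

/-! ### The frequency maps in coordinates -/

theorem act_sharp_shear_zpow_zero (k : ℤ) (x : Plane) :
    act (sharp (shearMatrix 0) ^ k) x = !₂[x 0, x 1 - k * x 0] := by
  have h1 : ∀ x : Plane, act (sharp (shearMatrix 0)) x = !₂[x 0, x 1 - x 0] := by
    intro x
    ext i
    fin_cases i <;>
    simp [act, sharp, shearMatrix, Matrix.toLpLin_apply, Matrix.GeneralLinearGroup.mkOfDetNeZero,
      Matrix.inv_def, Matrix.adjugate_fin_two]
    ring
  have h2 : ∀ x : Plane, act (sharp (shearMatrix 0))⁻¹ x = !₂[x 0, x 1 + x 0] := by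
    intro x
    refine act_injective (sharp (shearMatrix 0)) ?_
    rw [act_act_inv, h1]
    ext i
    fin_cases i <;> simp
  induction k generalizing x with
  | zero =>
    ext i
    fin_cases i <;> simp [act_one_apply]
  | succ k ih =>
    rw [_root_.zpow_add_one, act_mul_apply, h1, ih]
    ext i
    fin_cases i <;> simp
    ring
  | pred k ih =>
    rw [_root_.zpow_sub_one, act_mul_apply, h2, ih]
    ext i
    fin_cases i <;> simp
    ring

theorem act_sharp_shear_zpow_one (k : ℤ) (x : Plane) :
    act (sharp (shearMatrix 1) ^ k) x = !₂[x 0 - k * x 1, x 1] := by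
  have h1 : ∀ x : Plane, act (sharp (shearMatrix 1)) x = !₂[x 0 - x 1, x 1] := by
    intro x
    ext i
    fin_cases i <;>
    simp [act, sharp, shearMatrix, Matrix.toLpLin_apply, Matrix.GeneralLinearGroup.mkOfDetNeZero,
      Matrix.inv_def, Matrix.adjugate_fin_two]
    ring
  have h2 : ∀ x : Plane, act (sharp (shearMatrix 1))⁻¹ x = !₂[x 0 + x 1, x 1] := by
    intro x
    refine act_injective (sharp (shearMatrix 1)) ?_
    rw [act_act_inv, h1]
    ext i
    fin_cases i <;> simp
  induction k generalizing x with
  | zero =>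
    ext i
    fin_cases i <;> simp [act_one_apply]
  | succ k ih =>
    rw [_root_.zpow_add_one, act_mul_apply, h1, ih]
    ext i
    fin_cases i <;> simp
    ring
  | pred k ih =>
    rw [_root_.zpow_sub_one, act_mul_apply, h2, ih]
    ext i
    fin_cases i <;> simp
    ring

theorem act_scaling_zero (x : Plane) : act (scalingMatrix 0) x = !₂[4 * x 0, 2 * x 1] := by
  ext i
  fin_cases i <;>
  simp [act, scalingMatrix, Matrix.toLpLin_apply, Matrix.GeneralLinearGroup.mkOfDetNeZero] <;>
  rfl

theorem act_scaling_one (x : Plane) : act (scalingMatrix 1) x = !₂[2 * x 0, 4 * x 1] := by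
  ext i
  fin_cases i <;>
  simp [act, scalingMatrix, Matrix.toLpLin_apply, Matrix.GeneralLinearGroup.mkOfDetNeZero] <;>
  rfl

theorem act_scaling_pow_inv_zero (j : ℕ) (x : Plane) :
    act (scalingMatrix 0 ^ (-(j : ℤ))) x = !₂[x 0 / 4 ^ j, x 1 / 2 ^ j] := by
  induction j generalizing x with
  | zero =>
    ext i
    fin_cases i <;> simp [act_one_apply]
  | succ j ih =>
    refine act_injective (scalingMatrix 0) ?_
    rw [← act_mul_apply, ← _root_.zpow_one_add, show 1 + (-((j + 1 : ℕ) : ℤ)) = -(j : ℤ) by push_cast; ring,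
      ih, act_scaling_zero]
    ext i
    fin_cases i
    · simp only [Fin.zero_eta, Matrix.cons_val_zero, pow_succ]
      field_simp
    · simp only [Fin.mk_one, Matrix.cons_val_one, Matrix.cons_val_zero, pow_succ]
      field_simp

theorem act_scaling_pow_inv_one (j : ℕ) (x : Plane) :
    act (scalingMatrix 1 ^ (-(j : ℤ))) x = !₂[x 0 / 2 ^ j, x 1 / 4 ^ j] := by
  induction j generalizing x with
  | zero =>
    ext i
    fin_cases i <;> simp [act_one_apply]
  | succ j ih =>
    refine act_injective (scalingMatrix 1) ?_
    rw [← act_mul_apply, ← _root_.zpow_one_add, show 1 + (-((j + 1 : ℕ) : ℤ)) = -(j : ℤ) by push_cast; ring,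
      ih, act_scaling_one]
    ext i
    fin_cases i
    · simp only [Fin.zero_eta, Matrix.cons_val_zero, pow_succ]
      field_simp
    · simp only [Fin.mk_one, Matrix.cons_val_one, Matrix.cons_val_zero, pow_succ]
      field_simp

/-- The scaling matrices are diagonal, so transposition is invisible; this is why `freq` can use
`A_i^{-j}` in place of a power of `A_i♯`. -/
theorem sharp_scalingMatrix (i : Fin 2) : sharp (scalingMatrix i) = (scalingMatrix i)⁻¹ := by
  rw [eq_comm, inv_eq_iff_mul_eq_one]
  ext1
  have h : ((scalingMatrix i : GL2) : Matrix (Fin 2) (Fin 2) ℝ)ᵀ =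
      (scalingMatrix i : Matrix (Fin 2) (Fin 2) ℝ) := by
    fin_cases i <;> ext a b <;> fin_cases a <;> fin_cases b <;>
    simp [scalingMatrix, Matrix.GeneralLinearGroup.mkOfDetNeZero]
  rw [Units.val_mul]
  change (scalingMatrix i : Matrix (Fin 2) (Fin 2) ℝ) *
    (((scalingMatrix i)⁻¹ : GL2) : Matrix (Fin 2) (Fin 2) ℝ)ᵀ = _
  conv_lhs => rw [← h]
  rw [← Matrix.transpose_mul, Units.inv_mul]
  simp

theorem freq_eq_act_sharp (i : Fin 2) (j : ℕ) (k : ℤ) (ω : Plane) :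
    freq i j k ω = act (sharp (shearMatrix i ^ k * scalingMatrix i ^ j)) ω := by
  rw [freq, sharp_mul, sharp_zpow, ← zpow_natCast (scalingMatrix i) j, sharp_zpow,
    sharp_scalingMatrix, _root_.inv_zpow']

theorem norm_plane_le (x : Plane) : ‖x‖ ≤ |x 0| + |x 1| := by
  rw [EuclideanSpace.norm_eq, Fin.sum_univ_two, Real.sqrt_le_left (by positivity)]
  simp only [Real.norm_eq_abs]
  nlinarith [mul_nonneg (abs_nonneg (x 0)) (abs_nonneg (x 1))]

/-- The coordinate that the shear multiplies by `k` has been divided by `4^j`, so a shear with `|k|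
≤ 2^j` loses only `2^j` of this gain. The constant `3` counts the three resulting terms. -/
theorem norm_freq_le (i : Fin 2) (j : ℕ) (k : ℤ) (hk : k ∈ Finset.Icc (-(2 : ℤ) ^ j) ((2 : ℤ) ^ j))
    (ω : Plane) : ‖freq i j k ω‖ ≤ 3 * ‖ω‖ / 2 ^ j := by
  have hk' : |(k : ℝ)| ≤ 2 ^ j := by
    rw [Finset.mem_Icc] at hk
    rw [abs_le]
    constructor
    · exact_mod_cast hk.1
    · exact_mod_cast hk.2
  have h0 : |ω 0| ≤ ‖ω‖ := PiLp.norm_apply_le ω 0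
  have h1 : |ω 1| ≤ ‖ω‖ := PiLp.norm_apply_le ω 1
  have key : ∀ u v : ℝ, |u| ≤ ‖ω‖ → |v| ≤ ‖ω‖ →
      |u / 4 ^ j| + |v / 2 ^ j - k * (u / 4 ^ j)| ≤ 3 * ‖ω‖ / 2 ^ j := by
    intro u v hu hv
    have e4 : (4 : ℝ) ^ j = 2 ^ j * 2 ^ j := by rw [← mul_pow]; norm_num
    have hp : (1 : ℝ) ≤ 2 ^ j := one_le_pow₀ (by norm_num)
    have a1 : |u / 4 ^ j| ≤ ‖ω‖ / 2 ^ j := by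
      rw [abs_div, abs_of_pos (by positivity : (0 : ℝ) < 4 ^ j)]
      refine div_le_div₀ (norm_nonneg _) hu (by positivity) ?_
      rw [e4]
      nlinarith
    have a2 : |v / 2 ^ j| ≤ ‖ω‖ / 2 ^ j := by
      rw [abs_div, abs_of_pos (by positivity : (0 : ℝ) < 2 ^ j)]
      gcongr
    have a3 : |k * (u / 4 ^ j)| ≤ ‖ω‖ / 2 ^ j := by
      rw [abs_mul, abs_div, abs_of_pos (by positivity : (0 : ℝ) < 4 ^ j)]
      calc |(k : ℝ)| * (|u| / 4 ^ j) ≤ 2 ^ j * (‖ω‖ / 4 ^ j) := by gcongr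
        _ = ‖ω‖ / 2 ^ j := by
          rw [e4]
          field_simp
    calc _ ≤ ‖ω‖ / 2 ^ j + (‖ω‖ / 2 ^ j + ‖ω‖ / 2 ^ j) :=
          add_le_add a1 ((abs_sub _ _).trans (add_le_add a2 a3))
      _ = _ := by ring
  refine (norm_plane_le _).trans ?_
  rw [freq, act_mul_apply]
  fin_cases i
  · simp only [Fin.zero_eta, act_scaling_pow_inv_zero, act_sharp_shear_zpow_zero]
    simpa using key (ω 0) (ω 1) h0 h1
  · simp only [Fin.mk_one, act_scaling_pow_inv_one, act_sharp_shear_zpow_one]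
    rw [add_comm]
    simpa using key (ω 1) (ω 0) h1 h0

/-- The non-zero vectors of a lattice are bounded away from `0`. -/
theorem exists_pos_le_norm_of_mem_dualLattice (C : GL2) :
    ∃ δ : ℝ, 0 < δ ∧ ∀ d ∈ dualLattice C, d ≠ 0 → δ ≤ ‖d‖ := by
  set K := ‖(actEquiv (sharp C)⁻¹ : Plane →L[ℝ] Plane)‖ with hK
  refine ⟨(K + 1)⁻¹, by positivity, ?_⟩
  rintro d ⟨n, rfl⟩ hd
  have hn : ∃ i, n i ≠ 0 := by
    by_contra! h
    refine hd ?_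
    have : (WithLp.toLp 2 fun i : Fin 2 => ((n i : ℤ) : ℝ)) = 0 := by
      ext i
      simp [h i]
    exact (congrArg (act (sharp C)) this).trans (map_zero _)
  obtain ⟨i, hi⟩ := hn
  set x : Plane := WithLp.toLp 2 fun i : Fin 2 => ((n i : ℤ) : ℝ) with hx
  change _ ≤ ‖act (sharp C) x‖
  have h1 : (1 : ℝ) ≤ ‖x‖ := by
    refine le_trans ?_ (PiLp.norm_apply_le x i)
    change (1 : ℝ) ≤ |((n i : ℤ) : ℝ)|
    exact_mod_cast Int.one_le_abs hi
  have h2 : ‖x‖ ≤ K * ‖act (sharp C) x‖ := by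
    have := (actEquiv (sharp C)⁻¹ : Plane →L[ℝ] Plane).le_opNorm (act (sharp C) x)
    simpa [act_inv_act] using this
  rw [inv_le_iff_one_le_mul₀ (by positivity)]
  nlinarith [norm_nonneg (act (sharp C) x)]

theorem finite_setOf_scaleShear_le (J : ℕ) : {s : ScaleShear | s.1 ≤ J}.Finite := by
  refine ((Finset.range (J + 1)).sigma fun _ => Finset.univ).finite_toSet.subset fun s hs => ?_
  simpa [Nat.lt_succ_iff] using hs

/-! ### The shearlet system as a layered system -/

/-- The layers of the cone-adapted shearlet system: the translates of `φ`, and one layer for each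
`i` and `(j, k)`. -/
abbrev ShearletLayer : Type := Unit ⊕ (Fin 2 × ScaleShear)

/-- The dilation matrices of the layers. -/
def shearletMatrix : ShearletLayer → GL2
  | .inl _ => 1
  | .inr (i, s) => shearMatrix i ^ (s.2 : ℤ) * scalingMatrix i ^ s.1

/-- The generators of the layers. -/
def shearletGenerator (φ : L2) (ψ : Fin 2 → L2) : ShearletLayer → L2
  | .inl _ => φ
  | .inr (i, _) => ψ i

theorem inl_mem_layerKappa {C : GL2} {α : Plane} {u : Unit} :
    Sum.inl u ∈ layerKappa C shearletMatrix α ↔ α ∈ dualLattice C := by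
  simp [layerKappa, shearletMatrix, sharp_one, act_one_apply]

theorem inr_mem_layerKappa {C : GL2} {α : Plane} {i : Fin 2} {s : ScaleShear} :
    Sum.inr (i, s) ∈ layerKappa C shearletMatrix α ↔ s ∈ kappa C i α := by
  simp [layerKappa, shearletMatrix, kappa, freq_eq_act_sharp]

/-- If a non-zero `α` of norm at most `R` lies in an annihilator of scale `j`, its image under
`freq` is a non-zero vector of `Γ*` of norm at most `3R/2^j`; hence `j` is bounded. Each remaining
annihilator is a lattice and meets the ball in a finite set. -/
theorem locallyFinite_shearletMatrix (C : GL2) : LocallyFinite C shearletMatrix := by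
  intro R
  obtain ⟨δ, hδ, hmin⟩ := exists_pos_le_norm_of_mem_dualLattice C
  obtain ⟨J, hJ⟩ := pow_unbounded_of_one_lt (3 * R / δ) (one_lt_two (α := ℝ))
  have hlayer : ∀ p : ShearletLayer,
      {α : Plane | ‖α‖ ≤ R ∧ p ∈ layerKappa C shearletMatrix α}.Finite := by
    intro p
    obtain ⟨R', hR'⟩ := exists_norm_ofLp_act_inv_le ((sharp (shearletMatrix p))⁻¹ * sharp C)
      (isCompact_closedBall (0 : Plane) R)
    refine ((finite_setOf_norm_intVec_le R').image fun n =>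
      act ((sharp (shearletMatrix p))⁻¹ * sharp C) (WithLp.toLp 2 (intVec n))).subset ?_
    rintro α ⟨hα, hp⟩
    obtain ⟨n, rfl⟩ := (mem_dualLattice_iff C (shearletMatrix p) α).1 hp
    exact ⟨n, hR' _ (by simpa using hα), rfl⟩
  have hP : ({p | ∀ q, p = Sum.inr q → q.2.1 ≤ J} : Set ShearletLayer).Finite := by
    refine ((Set.finite_range Sum.inl).union (((Set.finite_univ (α := Fin 2)).prod
      (finite_setOf_scaleShear_le J)).image Sum.inr)).subset ?_
    rintro (u | q) hq
    · exact Or.inl ⟨u, rfl⟩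
    · exact Or.inr ⟨q, ⟨Set.mem_univ _, hq q rfl⟩, rfl⟩
  refine (hP.biUnion fun p _ => (hlayer p).image fun α => (p, α)).subset ?_
  rintro ⟨p, α⟩ ⟨hα0, hαR, hp⟩
  simp only at hα0 hαR hp
  refine Set.mem_biUnion (x := p) ?_ ⟨α, ⟨hαR, hp⟩, rfl⟩
  rintro ⟨i, s⟩ rfl
  by_contra! hlt
  have h1 := inr_mem_layerKappa.1 hp
  have h2 : freq i s.1 s.2 α ≠ 0 := by
    rw [freq]
    exact fun h0 => hα0 (act_injective _ (h0.trans (map_zero _).symm))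
  have h3 := (hmin _ h1 h2).trans (norm_freq_le i s.1 s.2 s.2.2 α)
  rw [div_lt_iff₀ hδ] at hJ
  rw [le_div_iff₀ (by positivity)] at h3
  have h4 : (2 : ℝ) ^ J ≤ 2 ^ s.1 := pow_le_pow_right₀ (by norm_num) hlt.le
  nlinarith

theorem finite_kappa (C : GL2) (i : Fin 2) {α : Plane} (hα : α ≠ 0) : (kappa C i α).Finite := by
  refine (((locallyFinite_shearletMatrix C).finite_layerKappa hα).preimage
    (f := fun s : ScaleShear => (Sum.inr (i, s) : ShearletLayer)) ?_).subset fun s hs =>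
      inr_mem_layerKappa.2 hs
  intro s _ s' _ h
  simpa using h

theorem profile_inl (φ : L2) (ψ : Fin 2 → L2) (u : Unit) (ω : Plane) :
    profile (shearletMatrix (.inl u)) (shearletGenerator φ ψ (.inl u)) ω = (𝓕 φ : L2) ω := by
  simp only [profile, shearletMatrix, shearletGenerator, sharp_one, act_one_apply]

theorem profile_inr (φ : L2) (ψ : Fin 2 → L2) (i : Fin 2) (s : ScaleShear) (ω : Plane) :
    profile (shearletMatrix (.inr (i, s))) (shearletGenerator φ ψ (.inr (i, s))) ω =
      (𝓕 (ψ i) : L2) (freq i s.1 s.2 ω) := by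
  simp only [profile, shearletMatrix, shearletGenerator, freq_eq_act_sharp]

theorem t0_eq_calderonSum (C : GL2) (φ : L2) (ψ : Fin 2 → L2) (ω : Plane) :
    t0 C φ ψ ω = calderonSum C shearletMatrix (shearletGenerator φ ψ) ω := by
  rw [t0, calderonSum, Summable.tsum_sum ENNReal.summable ENNReal.summable, ENNReal.tsum_prod',
    tsum_fintype, tsum_fintype]
  simp [profile_inl, profile_inr]

/-- Since `α ≠ 0`, only finitely many layers contribute, which justifies splitting the complex
series over the disjoint union and then over `i`. -/
theorem t_eq_autoCorr (C : GL2) (φ : L2) (ψ : Fin 2 → L2) {α : Plane} (hα : α ≠ 0) (ω : Plane) :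
    t C φ ψ α ω = autoCorr C shearletMatrix (shearletGenerator φ ψ) α ω := by
  classical
  set h : ShearletLayer → ℂ := (layerKappa C shearletMatrix α).indicator fun p =>
    profile (shearletMatrix p) (shearletGenerator φ ψ p) ω *
      conj (profile (shearletMatrix p) (shearletGenerator φ ψ p) (ω + α)) with hh
  have hfin : h.support.Finite :=
    ((locallyFinite_shearletMatrix C).finite_layerKappa hα).subset Set.support_indicator_subset
  have hinr : Summable (h ∘ Sum.inr) :=
    summable_of_hasFiniteSupport (hfin.preimage Sum.inr_injective.injOn)
  have hi : ∀ i s, h (Sum.inr (i, s)) = (kappa C i α).indicator (fun s : ScaleShear =>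
      (𝓕 (ψ i) : L2) (freq i s.1 s.2 ω) * conj ((𝓕 (ψ i) : L2) (freq i s.1 s.2 (ω + α)))) s := by
    intro i s
    simp only [hh, Set.indicator, inr_mem_layerKappa, profile_inr]
  have hl : h (Sum.inl ()) = if α ∈ dualLattice C then
      (𝓕 φ : L2) ω * conj ((𝓕 φ : L2) (ω + α)) else 0 := by
    simp only [hh, Set.indicator, inl_mem_layerKappa, profile_inl]
  rw [autoCorr, tsum_subtype (layerKappa C shearletMatrix α) (fun p =>
    profile (shearletMatrix p) (shearletGenerator φ ψ p) ω *
      conj (profile (shearletMatrix p) (shearletGenerator φ ψ p) (ω + α))), ← hh,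
    Summable.tsum_sum (summable_of_hasFiniteSupport (Set.toFinite _)) hinr, tsum_fintype,
    Finset.univ_unique, Finset.sum_singleton]
  have hprod : ∑' q : Fin 2 × ScaleShear, h (Sum.inr q) =
      ∑ i : Fin 2, ∑' s : ScaleShear, h (Sum.inr (i, s)) := by
    rw [hinr.tsum_prod (f := fun q => h (Sum.inr q)), tsum_fintype]
  rw [hprod]
  simp only [hi]
  rw [t]
  congr 2
  · exact hl.symm
  · refine Finset.sum_congr rfl fun i _ => ?_
    exact tsum_subtype (kappa C i α) (fun s : ScaleShear =>
      (𝓕 (ψ i) : L2) (freq i s.1 s.2 ω) * conj ((𝓕 (ψ i) : L2) (freq i s.1 s.2 (ω + α))))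

theorem injective_lattice (C : GL2) :
    Function.Injective fun n : Fin 2 → ℤ => act C (WithLp.toLp 2 fun i => (n i : ℝ)) := by
  intro m n hmn
  ext i
  exact Int.cast_injective (congrFun (WithLp.toLp_injective 2 (act_injective C hmn)) i)

/-- The index set of the shearlet system in terms of layers and integer vectors. -/
def layerIndexEquiv (C : GL2) : ShearletLayer × (Fin 2 → ℤ) ≃ SystemIndex C :=
  ((Equiv.refl _).prodCongr (Equiv.ofInjective _ (injective_lattice C))).trans <|
    (Equiv.sumProdDistrib _ _ _).trans <|
      Equiv.sumCongr (Equiv.punitProd _) (Equiv.prodAssoc _ _ _)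

theorem shearletSystem_layerIndexEquiv (C : GL2) (φ : L2) (ψ : Fin 2 → L2)
    (p : ShearletLayer × (Fin 2 → ℤ)) :
    shearletSystem C φ ψ (layerIndexEquiv C p) =
      layerSystem C shearletMatrix (shearletGenerator φ ψ) p := by
  obtain ⟨_ | ⟨i, s⟩, n⟩ := p
  · exact (dilate_one _).symm
  · rfl

theorem IsFrameWithBounds.of_equiv {ι κ : Type*} (e : ι ≃ κ) {u : ι → L2} {v : κ → L2} {A B : ℝ}
    (h : IsFrameWithBounds u A B) (hv : ∀ n, v (e n) = u n) : IsFrameWithBounds v A B := by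
  refine ⟨h.1, h.2.1, fun f => ?_⟩
  have h1 : (fun n => ‖⟪u n, f⟫_ℂ‖ ^ 2) = (fun n => ‖⟪v n, f⟫_ℂ‖ ^ 2) ∘ e := by
    ext n
    simp [hv]
  have h2 := h.2.2 f
  rw [← e.tsum_eq (fun n => ‖⟪v n, f⟫_ℂ‖ ^ 2), ← e.summable_iff, ← h1]
  simpa only [← hv] using h2

theorem layerKappa_nonempty_iff {C : GL2} {α : Plane} :
    (layerKappa C shearletMatrix α).Nonempty ↔ α ∈ annihilatorUnion C := by
  constructor
  · rintro ⟨u | ⟨i, s⟩, hp⟩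
    · exact Or.inl (inl_mem_layerKappa.1 hp)
    · exact Or.inr ⟨i, s, inr_mem_layerKappa.1 hp⟩
  · rintro (h | ⟨i, s, h⟩)
    · exact ⟨Sum.inl (), inl_mem_layerKappa.2 h⟩
    · exact ⟨Sum.inr (i, s), inr_mem_layerKappa.2 h⟩

theorem sum_enorm_t_le_remainder (C : GL2) (φ : L2) (ψ : Fin 2 → L2) (E : Finset Plane)
    (hE : ∀ α ∈ E, α ≠ 0 ∧ α ∈ annihilatorUnion C) (ω : Plane) :
    ∑ α ∈ E, ‖t C φ ψ α ω‖ₑ ≤ remainder C φ ψ ω := by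
  classical
  have h1 : ∑ α ∈ E, ‖t C φ ψ α ω‖ₑ =
      ∑ α ∈ E.subtype (· ∈ annihilatorUnion C \ {0}), ‖t C φ ψ α ω‖ₑ :=
    (Finset.sum_subtype_of_mem (fun α => ‖t C φ ψ α ω‖ₑ) fun α hα =>
      ⟨(hE α hα).2, (hE α hα).1⟩).symm
  rw [h1]
  exact ENNReal.sum_le_tsum _

/-- The frame estimate for the cone-adapted shearlet system. -/
theorem isFrameWithBounds_shearletSystem (C : GL2) (φ : L2) (ψ : Fin 2 → L2)
    (hb : b₁ C φ ψ < ⊤) (ha : 0 < a₁ C φ ψ) :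
    IsFrameWithBounds (shearletSystem C φ ψ) (a₁ C φ ψ).toReal (b₁ C φ ψ).toReal := by
  have hb1 : ∀ᵐ ω, t0 C φ ψ ω + remainder C φ ψ ω ≤ b₁ C φ ψ := ENNReal.ae_le_essSup _
  have ha1 : ∀ᵐ ω, a₁ C φ ψ ≤ (t0 C φ ψ ω : EReal) - (remainder C φ ψ ω : EReal) := ae_essInf_le
  -- Finiteness of `b₁` makes both quantities finite almost everywhere, so the difference in `EReal`
  -- is an ordinary real difference.
  have hreal : ∀ᵐ ω, t0 C φ ψ ω ≠ ⊤ ∧ remainder C φ ψ ω ≠ ⊤ ∧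
      (t0 C φ ψ ω).toReal + (remainder C φ ψ ω).toReal ≤ (b₁ C φ ψ).toReal ∧
      a₁ C φ ψ ≤ (((t0 C φ ψ ω).toReal - (remainder C φ ψ ω).toReal : ℝ) : EReal) := by
    filter_upwards [hb1, ha1] with ω h1 h2
    have h3 := ENNReal.add_ne_top.1 (h1.trans_lt hb).ne
    refine ⟨h3.1, h3.2, ?_, ?_⟩
    · rw [← ENNReal.toReal_add h3.1 h3.2]
      exact ENNReal.toReal_mono hb.ne h1
    · rw [EReal.coe_sub, ← EReal.toReal_coe_ennreal, ← EReal.toReal_coe_ennreal,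
        EReal.coe_toReal (by simpa using h3.1) (EReal.coe_ennreal_ne_bot _),
        EReal.coe_toReal (by simpa using h3.2) (EReal.coe_ennreal_ne_bot _)]
      exact h2
  -- A single good point shows that `a₁` is finite and, as `a₁ > 0`, that `b₁` is positive.
  obtain ⟨ω₀, -, -, h3, h4⟩ := hreal.exists
  have hatop : a₁ C φ ψ ≠ ⊤ := fun h => by
    rw [h, top_le_iff] at h4
    exact EReal.coe_ne_top _ h4
  have hacoe : ((a₁ C φ ψ).toReal : EReal) = a₁ C φ ψ :=
    EReal.coe_toReal hatop (ne_bot_of_gt ha)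
  have hapos : 0 < (a₁ C φ ψ).toReal := by
    rw [← hacoe] at ha
    exact_mod_cast ha
  have hbpos : 0 < (b₁ C φ ψ).toReal := by
    rw [← hacoe, EReal.coe_le_coe_iff] at h4
    have := ENNReal.toReal_nonneg (a := remainder C φ ψ ω₀)
    linarith
  refine IsFrameWithBounds.of_equiv (layerIndexEquiv C)
    (isFrameWithBounds_layerSystem (M := shearletMatrix) (ψ := shearletGenerator φ ψ)
      (locallyFinite_shearletMatrix C) hapos hbpos ?_ ?_) (shearletSystem_layerIndexEquiv C φ ψ)
  · filter_upwards [hb1] with ω h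
    rw [← t0_eq_calderonSum, ENNReal.ofReal_toReal hb.ne]
    exact le_self_add.trans h
  · filter_upwards [hreal] with ω h E hE
    obtain ⟨-, h2, h3, h4⟩ := h
    rw [← hacoe, EReal.coe_le_coe_iff] at h4
    have h5 : ∑ α ∈ E, ‖autoCorr C shearletMatrix (shearletGenerator φ ψ) α ω‖ ≤
        (remainder C φ ψ ω).toReal := by
      have e1 := ENNReal.toReal_mono h2 (sum_enorm_t_le_remainder C φ ψ E
        (fun α hα => ⟨(hE α hα).1, layerKappa_nonempty_iff.1 (hE α hα).2⟩) ω)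
      rw [ENNReal.toReal_sum fun α _ => enorm_ne_top] at e1
      refine le_trans (le_of_eq (Finset.sum_congr rfl fun α hα => ?_)) e1
      rw [toReal_enorm, t_eq_autoCorr C φ ψ (hE α hα).1]
    rw [← t0_eq_calderonSum]
    constructor <;> linarith

/-! ### Adapted lattices -/

namespace IsAdapted

variable {C : GL2}

theorem act_sharp_shear_zpow_mem_iff (h : IsAdapted C) (i : Fin 2) (k : ℤ) (x : Plane) :
    act (sharp (shearMatrix i) ^ k) x ∈ dualLattice C ↔ x ∈ dualLattice C := by
  have h1 : ∀ x, act (sharp (shearMatrix i)) x ∈ dualLattice C ↔ x ∈ dualLattice C := by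
    intro x
    conv_lhs => rw [← (h i).2]
    exact (act_injective _).mem_set_image
  induction k generalizing x with
  | zero => rw [zpow_zero, act_one_apply]
  | succ k ih =>
    rw [_root_.zpow_add_one, act_mul_apply]
    exact (ih _).trans (h1 x)
  | pred k ih =>
    rw [_root_.zpow_sub_one, act_mul_apply]
    exact (ih _).trans (by rw [← h1, act_act_inv])

theorem act_scaling_pow_mem (h : IsAdapted C) (i : Fin 2) (j : ℕ) {x : Plane} (hx : x ∈ dualLattice C) :
    act (scalingMatrix i ^ j) x ∈ dualLattice C := by
  induction j with
  | zero => rwa [pow_zero, act_one_apply]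
  | succ j ih =>
    rw [pow_succ', act_mul_apply]
    exact (h i).1 ⟨_, ih, rfl⟩

theorem freq_mem_iff (h : IsAdapted C) (i : Fin 2) (j : ℕ) (k : ℤ) (α : Plane) :
    freq i j k α ∈ dualLattice C ↔ act (scalingMatrix i ^ (-(j : ℤ))) α ∈ dualLattice C := by
  rw [freq, act_mul_apply, h.act_sharp_shear_zpow_mem_iff]

theorem annihilatorUnion_eq (h : IsAdapted C) : annihilatorUnion C = dualLattice C := by
  refine Set.Subset.antisymm ?_ fun α hα => Or.inl hα
  rintro α (hα | ⟨i, s, hs⟩)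
  · exact hα
  · have h1 := h.act_scaling_pow_mem i s.1 ((h.freq_mem_iff i s.1 s.2 α).1 hs)
    rwa [← act_mul_apply, ← zpow_natCast, ← _root_.zpow_add, add_neg_cancel, zpow_zero,
      act_one_apply] at h1

/-- For `j > m`, membership of `A_i^{m-j} q` in `Γ*` would give `q ∈ A_i Γ*` after applying
`A_i^{j-m-1}`; for `j ≤ m` the exponent is non-negative. In particular `m` is determined by `α`. -/
theorem act_scaling_zpow_neg_mem_iff (h : IsAdapted C) {i : Fin 2} {α : Plane} {m : ℕ} {q : Plane}
    (hd : IsDecomposition C i α m q) (j : ℕ) :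
    act (scalingMatrix i ^ (-(j : ℤ))) α ∈ dualLattice C ↔ j ≤ m := by
  obtain ⟨⟨hq, hqA⟩, rfl⟩ := hd
  rw [← act_mul_apply, ← zpow_natCast, ← _root_.zpow_add]
  constructor
  · intro hj
    by_contra! hlt
    obtain ⟨l, rfl⟩ := Nat.exists_eq_add_of_lt hlt
    refine hqA ⟨_, h.act_scaling_pow_mem i l hj, ?_⟩
    rw [← act_mul_apply, ← act_mul_apply, ← zpow_natCast, ← _root_.zpow_one_add,
      ← _root_.zpow_add]
    have : 1 + (l : ℤ) + (-((m + l + 1 : ℕ) : ℤ) + m) = 0 := by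
      push_cast
      ring
    rw [this, zpow_zero, act_one_apply]
  · intro hj
    obtain ⟨l, rfl⟩ := Nat.exists_eq_add_of_le hj
    have : -(j : ℤ) + ((j + l : ℕ) : ℤ) = (l : ℤ) := by
      push_cast
      ring
    rw [this, zpow_natCast]
    exact h.act_scaling_pow_mem i l hq

theorem existsUnique_isDecomposition (h : IsAdapted C) (i : Fin 2) {α : Plane} (hα : α ∈ dualLattice C)
    (hα0 : α ≠ 0) : ∃! p : ℕ × Plane, IsDecomposition C i α p.1 p.2 := by
  -- Otherwise all pairs `(j, 0)` would lie in `κ_i(α)`, which is finite for `α ≠ 0`.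
  have hex : ∃ j : ℕ, act (scalingMatrix i ^ (-(j : ℤ))) α ∉ dualLattice C := by
    by_contra! hall
    refine Set.infinite_of_injective_forall_mem (s := kappa C i α)
      (f := fun j : ℕ => (⟨j, 0, by simp⟩ : ScaleShear)) ?_ ?_ (finite_kappa C i hα0)
    · intro j j' hj
      exact congrArg Sigma.fst hj
    · intro j
      exact (h.freq_mem_iff i j _ α).2 (hall j)
  obtain ⟨n, hn, hmin⟩ : ∃ n : ℕ, act (scalingMatrix i ^ (-(n : ℤ))) α ∉ dualLattice C ∧
      ∀ j < n, act (scalingMatrix i ^ (-(j : ℤ))) α ∈ dualLattice C := by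
    classical
    exact ⟨Nat.find hex, Nat.find_spec hex, fun j hj => not_not.1 (Nat.find_min hex hj)⟩
  -- The first failing exponent is not `0` because `α ∈ Γ*`; the exponent sought is its predecessor.
  obtain ⟨m, rfl⟩ : ∃ m, n = m + 1 := by
    refine Nat.exists_eq_succ_of_ne_zero ?_
    rintro rfl
    refine hn ?_
    simpa [act_one_apply] using hα
  have hm0 := hmin m (Nat.lt_succ_self m)
  have hdec : IsDecomposition C i α m (act (scalingMatrix i ^ (-(m : ℤ))) α) := by
    refine ⟨⟨hm0, ?_⟩, ?_⟩
    · rintro ⟨x, hx, hxe⟩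
      refine hn ?_
      have : -((m + 1 : ℕ) : ℤ) = -1 + -(m : ℤ) := by
        push_cast
        ring
      rwa [this, _root_.zpow_add, act_mul_apply, ← hxe, _root_.zpow_neg_one, act_inv_act]
    · rw [← act_mul_apply, ← zpow_natCast, ← _root_.zpow_add, add_neg_cancel, zpow_zero,
        act_one_apply]
  refine ⟨(m, _), hdec, ?_⟩
  rintro ⟨m', q'⟩ hd'
  have hle : m' = m := by
    refine le_antisymm ?_ ?_
    · rw [← h.act_scaling_zpow_neg_mem_iff hdec, h.act_scaling_zpow_neg_mem_iff hd']
    · rw [← h.act_scaling_zpow_neg_mem_iff hd', h.act_scaling_zpow_neg_mem_iff hdec]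
  subst hle
  refine Prod.ext rfl (act_injective (scalingMatrix i ^ m') ?_)
  exact hd'.2.symm.trans hdec.2

/-- Adaptedness makes `κ_i(α)` the set of all pairs with `j ≤ m_i` and no further condition on `k`,
so the sum over it is an iterated finite sum. -/
theorem t_eq (h : IsAdapted C) (φ : L2) (ψ : Fin 2 → L2) {α : Plane} (hα : α ∈ dualLattice C) {m : Fin 2 → ℕ}
    {q : Fin 2 → Plane} (hd : ∀ i, IsDecomposition C i α (m i) (q i)) (ω : Plane) :
    t C φ ψ α ω = ((absDet C)⁻¹ : ℝ) * ((𝓕 φ : L2) ω * conj ((𝓕 φ : L2) (ω + α)) +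
      ∑ i : Fin 2, ∑ j ∈ Finset.range (m i + 1), ∑ k ∈ Finset.Icc (-(2 : ℤ) ^ j) ((2 : ℤ) ^ j),
        (𝓕 (ψ i) : L2) (freq i j k ω) * conj ((𝓕 (ψ i) : L2) (freq i j k (ω + α)))) := by
  rw [t, if_pos hα]
  congr 2
  refine Finset.sum_congr rfl fun i _ => ?_
  have hmem : ∀ s : ScaleShear, s ∈ kappa C i α ↔ s.1 ≤ m i := fun s =>
    (h.freq_mem_iff i s.1 s.2 α).trans (h.act_scaling_zpow_neg_mem_iff (hd i) s.1)
  set u : ScaleShear → ℂ := fun s =>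
    (𝓕 (ψ i) : L2) (freq i s.1 s.2 ω) * conj ((𝓕 (ψ i) : L2) (freq i s.1 s.2 (ω + α))) with hu
  rw [tsum_subtype (kappa C i α) u,
    tsum_eq_sum (s := (Finset.range (m i + 1)).sigma fun _ => Finset.univ), Finset.sum_sigma]
  · refine Finset.sum_congr rfl fun j hj => ?_
    rw [← Finset.sum_coe_sort (Finset.Icc (-(2 : ℤ) ^ j) ((2 : ℤ) ^ j)) (fun k =>
      (𝓕 (ψ i) : L2) (freq i j k ω) * conj ((𝓕 (ψ i) : L2) (freq i j k (ω + α))))]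
    refine Finset.sum_congr rfl fun k _ => ?_
    exact Set.indicator_of_mem ((hmem _).2 (Nat.lt_succ_iff.1 (Finset.mem_range.1 hj))) _
  · intro s hs
    refine Set.indicator_of_notMem (fun hk => hs ?_) _
    exact Finset.mem_sigma.2
      ⟨Finset.mem_range.2 (Nat.lt_succ_iff.2 ((hmem s).1 hk)), Finset.mem_univ _⟩

end IsAdapted

end

end ConeShearlet

theorem mainTheorem6 (C : ConeShearlet.GL2) (φ : ConeShearlet.L2)
    (ψ : Fin 2 → ConeShearlet.L2) :
    -- the frame estimate
    (ConeShearlet.b₁ C φ ψ < ⊤ → 0 < ConeShearlet.a₁ C φ ψ →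
      ConeShearlet.IsFrameWithBounds (ConeShearlet.shearletSystem C φ ψ)
        (ConeShearlet.a₁ C φ ψ).toReal (ConeShearlet.b₁ C φ ψ).toReal) ∧
    -- the explicit form of the auto-correlation functions over an adapted lattice
    (ConeShearlet.IsAdapted C →
      ConeShearlet.annihilatorUnion C = ConeShearlet.dualLattice C ∧
      ∀ α ∈ ConeShearlet.dualLattice C, α ≠ 0 →
        (∀ i, ∃! p : ℕ × ConeShearlet.Plane, ConeShearlet.IsDecomposition C i α p.1 p.2) ∧
        ∀ (m : Fin 2 → ℕ) (q : Fin 2 → ConeShearlet.Plane),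
          (∀ i, ConeShearlet.IsDecomposition C i α (m i) (q i)) →
          ∀ ω : ConeShearlet.Plane,
            ConeShearlet.t C φ ψ α ω =
              ((ConeShearlet.absDet C)⁻¹ : ℝ) *
                ((𝓕 φ : ConeShearlet.L2) ω * conj ((𝓕 φ : ConeShearlet.L2) (ω + α)) +
                  ∑ i : Fin 2, ∑ j ∈ Finset.range (m i + 1),
                    ∑ k ∈ Finset.Icc (-(2 : ℤ) ^ j) ((2 : ℤ) ^ j),
                      (𝓕 (ψ i) : ConeShearlet.L2) (ConeShearlet.freq i j k ω) *
                        conj ((𝓕 (ψ i) : ConeShearlet.L2)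
                          (ConeShearlet.freq i j k (ω + α))))) := by
  refine ⟨ConeShearlet.isFrameWithBounds_shearletSystem C φ ψ, fun h =>
    ⟨h.annihilatorUnion_eq, fun α hα hα0 =>
      ⟨fun i => h.existsUnique_isDecomposition i hα hα0, fun m q hd ω => h.t_eq φ ψ hα hd ω⟩⟩⟩
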